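/- Let $L=(L_t)_{t\ge0}$ be a Lévy process on $\mathbb R^d$ (so $L_0=0$ a.s.), and let $f:[0,\infty)\to\mathbb R$ be a locally bounded measurable function. For a Lévy process $Z$ and $h\ge 0$, let $\int_0^h f(s)\,dZ_s$ denote the limit in probability of the elementary integrals $\sum_j c_j\,(Z_{t_{j+1}}-Z_{t_j})$ of uniformly bounded step functions $\sum_j c_j 1_{(t_j,t_{j+1}]}$ supported in $(0,h]$ and converging to $f$ Lebesgue-a.e. on $(0,h]$, and let $\int_0^\infty f(s)\,dZ_s$ be the limit in probability of $\int_0^h f(s)\,dZ_s$ as $h\to\infty$, when it exists. Suppose that $\int_0^\infty f(s)\,dL_s$ is well defined, i.e. that this limit exists. Let $\tilde L=(\tilde L_{s,t})_{s,t\ge0}$ be a Lévy sheet extending $L$, i.e. an $\mathbb R^d$-valued two-parameter process such that: (i) for all $s,t$, $\tilde L_{s,0}=\tilde L_{0,t}=0$ a.s.; (ii) almost surely, for all $s,t\ge 0$, the paths $\tilde L_{s,\cdot}$ and $\tilde L_{\cdot,t}$ are càdlàg; (iii) for $0\le t_1\le t_2$, the process $(\tilde L_{s,t_2}-\tilde L_{s,t_1})_{s\ge0}$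 is a Lévy process independent of $\sigma(\tilde L_{u,v}:u\ge0,\,0\le v\le t_1)$ and has the law of $(L_{(t_2-t_1)s})_{s\ge0}$; (iv) $(\tilde L_{s,t})_{s,t\ge0}$ and $(\tilde L_{t,s})_{s,t\ge0}$ have the same law. Then, for every $t\ge0$, the integrals $$X_t=\int_0^\infty f(s)\,dL_{ts}\qquad\text{and}\qquad \tilde X_t=\int_0^\infty f(s)\,d_s\tilde L_{t,s}$$ are well defined (each up to a null set), and: 1. the process $X=(X_t)_{t\ge0}$ is IDT (infinitely divisible with respect to time): for every integer $n\ge1$, $(X_{nt})_{t\ge0}$ has the same law as $(X^{(1)}_t+\dots+X^{(n)}_t)_{t\ge0}$, where $X^{(1)},\dots,X^{(n)}$ are independent copies of $X$; 2. $\tilde X=(\tilde X_t)_{t\ge0}$ is a Lévy process associated to $X$. That is, every version of $\tilde X$ starts at $0$ a.s., has independent and stationary increments and is continuous in probability; there is a version that moreover has almost surely càdlàg paths; and $X_t\stackrel{(law)}{=}\tilde X_t$ for each fixed $t\ge0$. -/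

import Mathlib

open MeasureTheory ProbabilityTheory Filter Topology
open scoped NNReal ENNReal

noncomputable section

namespace LevyIDT

/-- A path on `[0, ∞)` is càdlàg: right-continuous, with left limits. -/
def IsCadlag {E : Type*} [TopologicalSpace E] (g : ℝ≥0 → E) : Prop :=
  ∀ t, ContinuousWithinAt g (Set.Ici t) t ∧ ∃ l, Tendsto g (𝓝[<] t) (𝓝 l)

/-- Equality in law of two processes, i.e. of the two path-valued random variables for the product
σ-algebra (equivalently, equality of all finite-dimensional distributions). -/
def SameLaw {T Ω Ω' E : Type*} [MeasurableSpace Ω] [MeasurableSpace Ω'] [MeasurableSpace E]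
    (X : T → Ω → E) (P : Measure Ω) (Y : T → Ω' → E) (P' : Measure Ω') : Prop :=
  IdentDistrib (fun ω t => X t ω) (fun ω t => Y t ω) P P'

/-- A Lévy process in law, started at `0`: independent and stationary increments and continuity
in probability, without any requirement on the paths. -/
structure IsLevyInLaw {Ω E : Type*} [MeasurableSpace Ω] [NormedAddCommGroup E]
    [MeasurableSpace E] (Z : ℝ≥0 → Ω → E) (P : Measure Ω) : Prop where
  measurable : ∀ t, Measurable (Z t)
  start : ∀ᵐ ω ∂P, Z 0 ω = 0
  indep : HasIndepIncrements Z P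
  stationary : ∀ s t, IdentDistrib (fun ω => Z (s + t) ω - Z s ω) (fun ω => Z t ω - Z 0 ω) P P
  stochContinuous : ∀ t, TendstoInMeasure P Z (𝓝 t) (Z t)

/-- A Lévy process: a Lévy process in law whose paths are almost surely càdlàg. -/
structure IsLevy {Ω E : Type*} [MeasurableSpace Ω] [NormedAddCommGroup E]
    [MeasurableSpace E] (Z : ℝ≥0 → Ω → E) (P : Measure Ω) : Prop extends IsLevyInLaw Z P where
  cadlag : ∀ᵐ ω ∂P, IsCadlag (fun t => Z t ω)

/-- `M` is a Lévy sheet extending the Lévy process `L`. The two processes may live on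
different probability spaces, since the extension concerns the law only. -/
structure IsLevySheetExtending {Ω Ω' E : Type*} [MeasurableSpace Ω] [MeasurableSpace Ω']
    [NormedAddCommGroup E] [MeasurableSpace E]
    (M : ℝ≥0 → ℝ≥0 → Ω' → E) (P' : Measure Ω') (L : ℝ≥0 → Ω → E) (P : Measure Ω) : Prop where
  measurable : ∀ s t, Measurable (M s t)
  zero_right : ∀ s, ∀ᵐ ω ∂P', M s 0 ω = 0
  zero_left : ∀ t, ∀ᵐ ω ∂P', M 0 t ω = 0
  cadlag : ∀ᵐ ω ∂P', ∀ s t, IsCadlag (fun v => M s v ω) ∧ IsCadlag (fun u => M u t ω)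
  increment_levy : ∀ t₁ t₂, t₁ ≤ t₂ → IsLevy (fun s ω => M s t₂ ω - M s t₁ ω) P'
  /-- The increment is independent of the σ-algebra generated by all `M u v` with `v ≤ t₁`. -/
  increment_indep : ∀ t₁ t₂, t₁ ≤ t₂ →
    IndepFun (fun ω s => M s t₂ ω - M s t₁ ω)
      (fun ω (p : ℝ≥0 × Set.Iic t₁) => M p.1 p.2 ω) P'
  increment_law : ∀ t₁ t₂, t₁ ≤ t₂ →
    SameLaw (fun s ω => M s t₂ ω - M s t₁ ω) P' (fun s => L ((t₂ - t₁) * s)) P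
  symm_law : SameLaw (fun p : ℝ≥0 × ℝ≥0 => M p.1 p.2) P' (fun p : ℝ≥0 × ℝ≥0 => M p.2 p.1) P'

/-- The process `X` is infinitely divisible with respect to time: for every `n ≥ 1`,
`(X_{nt})_t` has the law of the sum of `n` independent copies of `X`. The independent copies are
realized on the `n`-fold product of the probability space, the `i`-th one as `X t (ω i)`. -/
structure IsIDT {Ω E : Type*} [MeasurableSpace Ω] [NormedAddCommGroup E]
    [MeasurableSpace E] (X : ℝ≥0 → Ω → E) (P : Measure Ω) : Prop where
  measurable : ∀ t, Measurable (X t)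
  law_eq : ∀ n : ℕ, 1 ≤ n →
    SameLaw (fun t => X ((n : ℝ≥0) * t)) P
      (fun t (ω : Fin n → Ω) => ∑ i, X t (ω i)) (Measure.pi fun _ => P)

/-- A step function `∑_{j < n} c_j 1_{(t_j, t_{j+1}]}` supported in `(0, h]`. -/
structure Step (h : ℝ≥0) where
  n : ℕ
  t : ℕ → ℝ≥0
  mono : Monotone t
  le : t n ≤ h
  c : ℕ → ℝ

namespace Step

variable {h : ℝ≥0}

/-- The function represented by a step. -/
def toFun (φ : Step h) (s : ℝ≥0) : ℝ :=
  ∑ j ∈ Finset.range φ.n, (Set.Ioc (φ.t j) (φ.t (j + 1))).indicator (fun _ => φ.c j) s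

/-- The elementary integral `∫ φ dZ = ∑_{j < n} c_j (Z_{t_{j+1}} - Z_{t_j})`. -/
def integral {Ω E : Type*} [NormedAddCommGroup E] [NormedSpace ℝ E]
    (φ : Step h) (Z : ℝ≥0 → Ω → E) (ω : Ω) : E :=
  ∑ j ∈ Finset.range φ.n, φ.c j • (Z (φ.t (j + 1)) ω - Z (φ.t j) ω)

end Step

/-- `I` is a version of the stochastic integral `∫_0^h f(s) dZ_s` of a bounded deterministic
function: it is the limit in probability of the elementary integrals of uniformly bounded step
functions converging to `f` Lebesgue-almost everywhere on `(0, h]`. (For a Lévy process `Z` the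
limit does not depend, up to null sets, on the choice of the approximating sequence, and it
exists for every measurable `f` that is bounded on `[0, h]`.) -/
def HasIntegral {Ω E : Type*} [MeasurableSpace Ω] [NormedAddCommGroup E] [NormedSpace ℝ E]
    [MeasurableSpace E] (f : ℝ≥0 → ℝ) (Z : ℝ≥0 → Ω → E) (P : Measure Ω) (h : ℝ≥0)
    (I : Ω → E) : Prop :=
  Measurable I ∧ ∃ φ : ℕ → Step h,
    (∃ C : ℝ, ∀ k s, |(φ k).toFun s| ≤ C) ∧
    (∀ᵐ s : ℝ, s ∈ Set.Ioc 0 (h : ℝ) →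
      Tendsto (fun k => (φ k).toFun s.toNNReal) atTop (𝓝 (f s.toNNReal))) ∧
    TendstoInMeasure P (fun k => (φ k).integral Z) atTop I

/-- `I` is a version of the improper stochastic integral `∫_0^∞ f(s) dZ_s`, the limit in
probability of `∫_0^h f(s) dZ_s` as `h → ∞`. -/
def HasImproperIntegral {Ω E : Type*} [MeasurableSpace Ω] [NormedAddCommGroup E]
    [NormedSpace ℝ E] [MeasurableSpace E] (f : ℝ≥0 → ℝ) (Z : ℝ≥0 → Ω → E) (P : Measure Ω)
    (I : Ω → E) : Prop :=
  Measurable I ∧ ∃ J : ℝ≥0 → Ω → E,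
    (∀ h, HasIntegral f Z P h (J h)) ∧ TendstoInMeasure P J atTop I

end LevyIDT

end

/-! Everything is computed with characteristic exponents. Since `L` is Lévy, `E exp(i⟨L_t, u⟩) =
exp(t ψ(u))` with `ψ` continuous and `ψ 0 = 0` (`IsLevyInLaw.exists_hasExponent`). A step function
`φ` then has an elementary integral with exponent `∫ ψ(φ(s) u) ds`, and by dominated convergence the
part of `∫ f dL` over `(a, b]` has exponent `∫_a^b ψ(f(s) u) ds`. Because a characteristic function
tending to `1` forces convergence to `0` in probability (`tendstoInMeasure_zero_of_tendsto_ch`),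
existence questions for integrals become convergence questions for these exponents.

If `∫_0^∞ f dL` exists, the exponentials of the tails tend to `1`; the primitive being continuous,
it cannot jump by multiples of `2πi`, so `∫_0^h ψ(f(s) u) ds` itself converges, to some `κ(u)`
(`exists_tendsto_of_cexp_sub`). For fixed `t`, both `L_{t·}` and `M_{t,·}` have step integrals with
exponents built from `tψ`, so both improper integrals exist and have characteristic function `exp(t
κ(u))`; this gives the equality of marginals.

The process statements are identities between joint characteristic functions that survive limits in
probability. Independent stationary increments are encoded in `HasExponent`: for step integrals of
the sheet it follows from the increment conditions and the symmetry in law. The IDT property is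
encoded in `TimeDivisible`: multiplying all times by `c` multiplies the joint exponents of `L` by
`c`.

For càdlàg versions, differences of approximants are again processes with exponents, and these tend
to `0`. Ottaviani's inequality upgrades this to convergence in probability uniform over `t ≤ T`, and
Borel–Cantelli gives an almost surely locally uniform limit. This is applied twice, for the step
approximation and for `h → ∞`. -/

noncomputable section

namespace LevyIDT

open scoped InnerProductSpace

/-! ### Linear operations on limits in measure. -/

section ConvergenceInMeasure

variable {Ω ι V W : Type*} [MeasurableSpace Ω] {P : Measure Ω} {l : Filter ι}
  [SeminormedAddCommGroup V] [SeminormedAddCommGroup W]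

lemma tendstoInMeasure_of_norm_sub_le_mul {F : ι → Ω → V} {G : Ω → V} {F' : ι → Ω → W}
    {G' : Ω → W} (c : ℝ) (h : TendstoInMeasure P F l G)
    (hc : ∀ i ω, ‖F' i ω - G' ω‖ ≤ c * ‖F i ω - G ω‖) : TendstoInMeasure P F' l G' := by
  rw [tendstoInMeasure_iff_norm] at h ⊢
  intro ε hε
  have hc' : 0 < |c| + 1 := by positivity
  refine tendsto_of_tendsto_of_tendsto_of_le_of_le tendsto_const_nhds (h (ε / (|c| + 1))
    (by positivity)) (fun _ => zero_le) fun i => measure_mono fun ω hω => ?_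
  simp only [Set.mem_ofPred_eq] at hω ⊢
  rw [div_le_iff₀ hc']
  have h1 := hc i ω
  have h2 : c * ‖F i ω - G ω‖ ≤ (|c| + 1) * ‖F i ω - G ω‖ :=
    mul_le_mul_of_nonneg_right (by linarith [le_abs_self c]) (norm_nonneg _)
  linarith

lemma tendstoInMeasure_const (G : Ω → V) : TendstoInMeasure P (fun _ : ι => G) l G := by
  rw [tendstoInMeasure_iff_norm]
  intro ε hε
  simpa [not_le.2 hε] using tendsto_const_nhds

lemma tendstoInMeasure_add {F F' : ι → Ω → V} {G G' : Ω → V} (h : TendstoInMeasure P F l G)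
    (h' : TendstoInMeasure P F' l G') :
    TendstoInMeasure P (fun i ω => F i ω + F' i ω) l (fun ω => G ω + G' ω) := by
  rw [tendstoInMeasure_iff_norm] at h h' ⊢
  intro ε hε
  have h2 := (h (ε / 2) (by positivity)).add (h' (ε / 2) (by positivity))
  rw [add_zero] at h2
  refine tendsto_of_tendsto_of_tendsto_of_le_of_le tendsto_const_nhds h2
    (fun _ => zero_le) fun i => ?_
  refine (measure_mono fun ω hω => ?_).trans (measure_union_le _ _)
  simp only [Set.mem_ofPred_eq, Set.mem_union] at hω ⊢
  by_contra! hcon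
  have : F i ω + F' i ω - (G ω + G' ω) = (F i ω - G ω) + (F' i ω - G' ω) := by abel
  rw [this] at hω
  linarith [norm_add_le (F i ω - G ω) (F' i ω - G' ω)]

lemma tendstoInMeasure_sub {F F' : ι → Ω → V} {G G' : Ω → V} (h : TendstoInMeasure P F l G)
    (h' : TendstoInMeasure P F' l G') :
    TendstoInMeasure P (fun i ω => F i ω - F' i ω) l (fun ω => G ω - G' ω) := by
  simp only [sub_eq_add_neg]
  refine tendstoInMeasure_add h (tendstoInMeasure_of_norm_sub_le_mul 1 h' fun i ω => ?_)
  rw [one_mul, ← neg_sub', norm_neg]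

lemma tendstoInMeasure_finsetSum {κ : Type*} (s : Finset κ) {F : κ → ι → Ω → V} {G : κ → Ω → V}
    (h : ∀ k ∈ s, TendstoInMeasure P (F k) l (G k)) :
    TendstoInMeasure P (fun i ω => ∑ k ∈ s, F k i ω) l (fun ω => ∑ k ∈ s, G k ω) := by
  classical
  induction s using Finset.induction with
  | empty => simpa using tendstoInMeasure_const (fun _ => (0 : V))
  | insert a s ha ih =>
    simp only [Finset.sum_insert ha]
    exact tendstoInMeasure_add (h a (Finset.mem_insert_self a s))
      (ih fun k hk => h k (Finset.mem_insert_of_mem hk))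

lemma tendstoInMeasure_inner {E : Type*} [NormedAddCommGroup E] [InnerProductSpace ℝ E]
    {F : ι → Ω → E} {G : Ω → E} (h : TendstoInMeasure P F l G) (u : E) :
    TendstoInMeasure P (fun i ω => ⟪F i ω, u⟫_ℝ) l (fun ω => ⟪G ω, u⟫_ℝ) := by
  refine tendstoInMeasure_of_norm_sub_le_mul ‖u‖ h fun i ω => ?_
  rw [← inner_sub_left, mul_comm]
  exact norm_inner_le_norm _ _

/-- A limit in measure to zero forces a limit of the difference. -/
lemma tendstoInMeasure_of_sub {F F' : ι → Ω → V} {G : Ω → V}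
    (h : TendstoInMeasure P (fun i ω => F i ω - F' i ω) l (fun _ => 0))
    (h' : TendstoInMeasure P F' l G) : TendstoInMeasure P F l G := by
  simpa using tendstoInMeasure_add h h'

end ConvergenceInMeasure

/-! ### Characteristic functions, convergence in probability and laws. -/

section Char

variable {Ω Ω' ι : Type*} [MeasurableSpace Ω] [MeasurableSpace Ω'] {P : Measure Ω}
  {P' : Measure Ω'}

/-- The value at `1` of the characteristic function of a real random variable. -/
def ch (P : Measure Ω) (R : Ω → ℝ) : ℂ := ∫ ω, Complex.exp (R ω * Complex.I) ∂P

lemma integrable_cexp_mul_I [IsFiniteMeasure P] {R : Ω → ℝ} (hR : AEMeasurable R P) :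
    Integrable (fun ω => Complex.exp (R ω * Complex.I)) P := by
  refine Integrable.of_bound (C := 1) ?_ (by simp [Complex.norm_exp_ofReal_mul_I])
  have : AEMeasurable (fun ω => Complex.exp (R ω * Complex.I)) P := by fun_prop
  exact this.aestronglyMeasurable

lemma ch_zero [IsProbabilityMeasure P] : ch P (fun _ => 0) = 1 := by simp [ch]

lemma ch_congr {R S : Ω → ℝ} (h : R =ᵐ[P] S) : ch P R = ch P S :=
  integral_congr_ae (h.mono fun ω hω => by simp only [hω])

lemma ch_identDistrib {R : Ω → ℝ} {S : Ω' → ℝ} (h : IdentDistrib R S P P') :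
    ch P R = ch P' S :=
  (h.comp (u := fun x : ℝ => Complex.exp (x * Complex.I)) (by fun_prop)).integral_eq

lemma norm_ch_le [IsProbabilityMeasure P] (R : Ω → ℝ) : ‖ch P R‖ ≤ 1 := by
  refine (norm_integral_le_of_norm_le_const (C := 1) (ae_of_all _ fun ω => ?_)).trans (by simp)
  rw [Complex.norm_exp_ofReal_mul_I]

lemma ch_add_of_indepFun {R S : Ω → ℝ} (hR : AEMeasurable R P) (hS : AEMeasurable S P)
    (h : IndepFun R S P) : ch P (fun ω => R ω + S ω) = ch P R * ch P S := by
  have hm : Measurable fun x : ℝ => Complex.exp (x * Complex.I) := by fun_prop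
  have h2 := (h.comp hm hm).integral_fun_mul_eq_mul_integral
    (hm.comp_aemeasurable hR).aestronglyMeasurable (hm.comp_aemeasurable hS).aestronglyMeasurable
  simp only [Function.comp_def] at h2
  rw [ch, ch, ch, ← h2]
  refine integral_congr_ae (ae_of_all _ fun ω => ?_)
  simp only
  rw [← Complex.exp_add]
  push_cast
  ring_nf

lemma measurable_inner_const {E : Type*} [NormedAddCommGroup E] [InnerProductSpace ℝ E]
    [MeasurableSpace E] [BorelSpace E] {X : Ω → E} (hX : Measurable X) (u : E) :
    Measurable fun ω => ⟪X ω, u⟫_ℝ := by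
  have hu : Continuous fun x : E => ⟪x, u⟫_ℝ := by fun_prop
  exact hu.measurable.comp hX

lemma measurable_inner_sub {E : Type*} [NormedAddCommGroup E] [InnerProductSpace ℝ E]
    [MeasurableSpace E] [BorelSpace E] [SecondCountableTopology E] {X Y : Ω → E}
    (hX : Measurable X) (hY : Measurable Y) (u : E) :
    Measurable fun ω => ⟪X ω - Y ω, u⟫_ℝ :=
  measurable_inner_const (hX.sub hY) u

lemma measurable_sum_inner_sub {κ E : Type*} [NormedAddCommGroup E] [InnerProductSpace ℝ E]
    [MeasurableSpace E] [BorelSpace E] [SecondCountableTopology E] {X Y : κ → Ω → E}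
    (s : Finset κ) (u : κ → E) (hX : ∀ j, Measurable (X j)) (hY : ∀ j, Measurable (Y j)) :
    Measurable fun ω => ∑ j ∈ s, ⟪X j ω - Y j ω, u j⟫_ℝ :=
  Finset.measurable_fun_sum _ fun j _ => measurable_inner_sub (hX j) (hY j) (u j)

lemma charFun_map_eq_ch {E : Type*} [NormedAddCommGroup E] [InnerProductSpace ℝ E]
    [MeasurableSpace E] [BorelSpace E] [SecondCountableTopology E]
    {X : Ω → E} (hX : AEMeasurable X P) (u : E) :
    charFun (P.map X) u = ch P (fun ω => ⟪X ω, u⟫_ℝ) := by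
  rw [charFun_apply, integral_map hX]
  · rfl
  · have : Measurable fun x : E => Complex.exp (⟪x, u⟫_ℝ * Complex.I) := by fun_prop
    exact this.aestronglyMeasurable

/-- The filter is arbitrary, so no subsequence argument is used but an explicit bound: `x ↦ exp(ix)`
is 1-Lipschitz, so the integrands differ by at most `ε` where `|R - S| < ε`, and by at most `2`
elsewhere. -/
lemma tendsto_ch [IsProbabilityMeasure P] {l : Filter ι} {R : ι → Ω → ℝ} {S : Ω → ℝ}
    (hR : ∀ i, AEMeasurable (R i) P) (hS : AEMeasurable S P) (h : TendstoInMeasure P R l S) :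
    Tendsto (fun i => ch P (R i)) l (𝓝 (ch P S)) := by
  rw [tendstoInMeasure_iff_measureReal_norm] at h
  have key : ∀ ε : ℝ, 0 < ε → ∀ i,
      ‖ch P (R i) - ch P S‖ ≤ ε + 2 * P.real {ω | ε ≤ ‖R i ω - S ω‖} := by
    intro ε hε i
    have hlip : ∀ a b : ℝ,
        ‖Complex.exp (a * Complex.I) - Complex.exp (b * Complex.I)‖ ≤ |a - b| := by
      intro a b
      have h1 : Complex.exp (a * Complex.I) - Complex.exp (b * Complex.I)
          = Complex.exp (b * Complex.I) * (Complex.exp (Complex.I * ((a - b : ℝ) : ℂ)) - 1) := by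
        rw [mul_sub, ← Complex.exp_add, mul_one]
        push_cast
        ring_nf
      rw [h1, norm_mul, Complex.norm_exp_ofReal_mul_I, one_mul]
      exact Real.norm_exp_I_mul_ofReal_sub_one_le
    obtain ⟨R', hR'm, hR'⟩ := hR i
    obtain ⟨S', hS'm, hS'⟩ := hS
    have hset : P.real {ω | ε ≤ ‖R i ω - S ω‖} = P.real {ω | ε ≤ ‖R' ω - S' ω‖} := by
      refine measureReal_congr ?_
      filter_upwards [hR', hS'] with ω h1 h2
      change (ε ≤ ‖R i ω - S ω‖) = (ε ≤ ‖R' ω - S' ω‖)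
      rw [h1, h2]
    rw [ch_congr hR', ch_congr hS', hset]
    set A := {ω | ε ≤ ‖R' ω - S' ω‖} with hA
    have hAm : MeasurableSet A := measurableSet_le (by fun_prop) (by fun_prop)
    rw [ch, ch, ← integral_sub (integrable_cexp_mul_I hR'm.aemeasurable)
      (integrable_cexp_mul_I hS'm.aemeasurable)]
    calc _ ≤ ∫ ω, (ε + A.indicator (fun _ => (2 : ℝ)) ω) ∂P := by
          refine norm_integral_le_of_norm_le ?_ (ae_of_all _ fun ω => ?_)
          · exact (integrable_const _).add ((integrable_const _).indicator hAm)
          · by_cases hω : ω ∈ A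
            · rw [Set.indicator_of_mem hω]
              refine (norm_sub_le _ _).trans ?_
              rw [Complex.norm_exp_ofReal_mul_I, Complex.norm_exp_ofReal_mul_I]
              linarith
            · rw [Set.indicator_of_notMem hω, add_zero]
              refine (hlip _ _).trans ?_
              simp only [hA, Set.mem_ofPred_eq, not_le, Real.norm_eq_abs] at hω
              exact hω.le
      _ = _ := by
          rw [integral_add (integrable_const _) ((integrable_const _).indicator hAm),
            integral_indicator hAm]
          simp [mul_comm]
  rw [Metric.tendsto_nhds]
  intro ε hε
  have h2 := (h (ε / 2) (by positivity)).eventually (gt_mem_nhds (show (0 : ℝ) < ε / 4 by positivity))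
  filter_upwards [h2] with i hi
  rw [dist_eq_norm]
  linarith [key (ε / 2) (by positivity) i]

lemma tendsto_ch_inner {E : Type*} [NormedAddCommGroup E] [InnerProductSpace ℝ E]
    [MeasurableSpace E] [BorelSpace E] [IsProbabilityMeasure P] {l : Filter ι} {X : ι → Ω → E} {Y : Ω → E}
    (hX : ∀ i, Measurable (X i)) (hY : Measurable Y) (h : TendstoInMeasure P X l Y) (u : E) :
    Tendsto (fun i => ch P (fun ω => ⟪X i ω, u⟫_ℝ)) l (𝓝 (ch P (fun ω => ⟪Y ω, u⟫_ℝ))) :=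
  tendsto_ch (fun i => (measurable_inner_const (hX i) u).aemeasurable)
    (measurable_inner_const hY u).aemeasurable (tendstoInMeasure_inner h u)

variable {E : Type*} [NormedAddCommGroup E] [InnerProductSpace ℝ E] [FiniteDimensional ℝ E]
  [MeasurableSpace E] [BorelSpace E]

/-- If the characteristic functions converge to `1` along a countably generated filter, the random
variables converge to zero in probability. -/
lemma tendstoInMeasure_zero_of_tendsto_ch [IsProbabilityMeasure P] {l : Filter ι}
    [l.IsCountablyGenerated] {X : ι → Ω → E} (hX : ∀ i, Measurable (X i))
    (h : ∀ u : E, Tendsto (fun i => ch P (fun ω => ⟪X i ω, u⟫_ℝ)) l (𝓝 1)) :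
    TendstoInMeasure P X l (fun _ => 0) := by
  have hsc : SecondCountableTopology E :=
    have := FiniteDimensional.proper_real E; inferInstance
  have hprob : ∀ i, IsProbabilityMeasure (P.map (X i)) := fun i =>
    Measure.isProbabilityMeasure_map (hX i).aemeasurable
  -- The tail of the projection onto `a` is bounded by an integral of `1 - charFun` over a bounded
  -- interval. Dominated convergence sends that integral to `0`; this is where the filter must be
  -- countably generated.
  have key : ∀ (a : E) (r : ℝ), 0 < r →
      Tendsto (fun i => (P.map (X i)).real {x | r < |⟪a, x⟫_ℝ|}) l (𝓝 0) := by
    intro a r hr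
    have hlim : Tendsto (fun i => ∫ t in (-2 * r⁻¹)..(2 * r⁻¹),
        (1 - charFun (P.map (X i)) (t • a))) l
        (𝓝 (∫ t in (-2 * r⁻¹)..(2 * r⁻¹), (0 : ℂ))) := by
      refine intervalIntegral.tendsto_integral_filter_of_dominated_convergence (fun _ => 2)
        ?_ ?_ (by simp) ?_
      · refine Eventually.of_forall fun i => ?_
        have : Measurable fun t : ℝ => 1 - charFun (P.map (X i)) (t • a) :=
          measurable_const.sub (measurable_charFun.comp (by fun_prop))
        exact this.aestronglyMeasurable
      · exact Eventually.of_forall fun i => ae_of_all _ fun t _ => norm_one_sub_charFun_le_two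
      · refine ae_of_all _ fun t _ => ?_
        have h1 := (h (t • a)).const_sub 1
        simp only [sub_self] at h1
        refine h1.congr fun i => ?_
        rw [charFun_map_eq_ch (hX i).aemeasurable]
    have hlim2 : Tendsto (fun i => 2⁻¹ * r * ‖∫ t in (-2 * r⁻¹)..(2 * r⁻¹),
        (1 - charFun (P.map (X i)) (t • a))‖) l (𝓝 0) := by
      have := hlim.norm.const_mul (2⁻¹ * r)
      simpa using this
    exact tendsto_of_tendsto_of_tendsto_of_le_of_le tendsto_const_nhds hlim2
      (fun _ => measureReal_nonneg) fun i => measureReal_abs_inner_gt_le_integral_charFun hr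
  set b := stdOrthonormalBasis ℝ E with hb
  have hcoord : ∀ k, TendstoInMeasure P (fun i ω => ⟪b k, X i ω⟫_ℝ • b k) l (fun _ => 0) := by
    intro k
    rw [tendstoInMeasure_iff_measureReal_norm]
    intro ε hε
    refine tendsto_of_tendsto_of_tendsto_of_le_of_le tendsto_const_nhds
      (key (b k) (ε / 2) (by positivity)) (fun _ => measureReal_nonneg) fun i => ?_
    rw [map_measureReal_apply (hX i) (measurableSet_lt (by fun_prop) (by fun_prop))]
    refine measureReal_mono (fun ω hω => ?_)
    simp only [sub_zero, Set.mem_ofPred_eq, norm_smul, b.norm_eq_one, mul_one,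
      Real.norm_eq_abs, Set.mem_preimage] at hω ⊢
    linarith
  have := tendstoInMeasure_finsetSum Finset.univ (fun k _ => hcoord k)
  simpa [b.sum_repr'] using this

/-- The law of a finite-dimensional process is determined by its joint characteristic functions. -/
lemma sameLaw_of_ch_eq [IsProbabilityMeasure P] [IsProbabilityMeasure P'] {T : Type*}
    {X : T → Ω → E} {Y : T → Ω' → E}
    (hX : ∀ t, Measurable (X t)) (hY : ∀ t, Measurable (Y t))
    (h : ∀ (s : Finset T) (u : T → E),
      ch P (fun ω => ∑ t ∈ s, ⟪X t ω, u t⟫_ℝ) = ch P' (fun ω => ∑ t ∈ s, ⟪Y t ω, u t⟫_ℝ)) :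
    SameLaw X P Y P' := by
  have hsc : SecondCountableTopology E :=
    have := FiniteDimensional.proper_real E; inferInstance
  have hXm : Measurable (fun ω t => X t ω) := measurable_pi_lambda _ hX
  have hYm : Measurable (fun ω t => Y t ω) := measurable_pi_lambda _ hY
  refine ⟨hXm.aemeasurable, hYm.aemeasurable, ?_⟩
  have : IsProbabilityMeasure (P'.map (fun ω t => Y t ω)) :=
    Measure.isProbabilityMeasure_map hYm.aemeasurable
  refine IsProjectiveLimit.unique (isProjectiveLimit_map hXm.aemeasurable) ?_
  intro I
  rw [isProjectiveLimit_map hYm.aemeasurable I]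
  have hXI : Measurable (fun ω => I.restrict (fun t => X t ω)) :=
    (Finset.measurable_restrict _).comp hXm
  have hYI : Measurable (fun ω => I.restrict (fun t => Y t ω)) :=
    (Finset.measurable_restrict _).comp hYm
  -- The finite product is transported to its `ℓ²` version, which carries the inner product that
  -- `charFun` needs.
  set e := (PiLp.continuousLinearEquiv 2 ℝ (fun _ : I => E)).symm.toHomeomorph.toMeasurableEquiv
  refine (MeasurableEquiv.map_measurableEquiv_injective e) ?_
  have := Measure.isProbabilityMeasure_map (μ := P') hYI.aemeasurable
  have := Measure.isProbabilityMeasure_map (μ := P) hXI.aemeasurable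
  have := Measure.isProbabilityMeasure_map (μ := P.map (fun ω => I.restrict (fun t => X t ω)))
    e.measurable.aemeasurable
  have := Measure.isProbabilityMeasure_map (μ := P'.map (fun ω => I.restrict (fun t => Y t ω)))
    e.measurable.aemeasurable
  refine Measure.ext_of_charFun (funext fun v => ?_)
  rw [Measure.map_map e.measurable hXI, Measure.map_map e.measurable hYI,
    charFun_map_eq_ch (e.measurable.comp hXI).aemeasurable,
    charFun_map_eq_ch (e.measurable.comp hYI).aemeasurable]
  classical
  have h1 := h I (fun t => if ht : t ∈ I then v ⟨t, ht⟩ else 0)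
  have conv : ∀ g : T → E, ⟪e (I.restrict g), v⟫_ℝ
      = ∑ t ∈ I, ⟪g t, if ht : t ∈ I then v ⟨t, ht⟩ else 0⟫_ℝ := by
    intro g
    rw [PiLp.inner_apply, ← Finset.sum_coe_sort I]
    refine Finset.sum_congr rfl fun t _ => ?_
    simp only [Finset.coe_mem, dite_true]
    rfl
  simpa only [Function.comp_def, conv] using h1.symm

lemma identDistrib_of_ch_eq [IsProbabilityMeasure P] [IsProbabilityMeasure P']
    {X : Ω → E} {Y : Ω' → E} (hX : Measurable X) (hY : Measurable Y)
    (h : ∀ u : E, ch P (fun ω => ⟪X ω, u⟫_ℝ) = ch P' (fun ω => ⟪Y ω, u⟫_ℝ)) :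
    IdentDistrib X Y P P' := by
  have hsc : SecondCountableTopology E :=
    have := FiniteDimensional.proper_real E; inferInstance
  refine ⟨hX.aemeasurable, hY.aemeasurable, ?_⟩
  have := Measure.isProbabilityMeasure_map (μ := P) hX.aemeasurable
  have := Measure.isProbabilityMeasure_map (μ := P') hY.aemeasurable
  refine Measure.ext_of_charFun (funext fun v => ?_)
  rw [charFun_map_eq_ch hX.aemeasurable, charFun_map_eq_ch hY.aemeasurable, h]

end Char

/-! ### Common grids for finitely many times. -/

section Grid

/-- Any finite set of times is contained in the range of a monotone sequence started at `0`. -/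
lemma exists_grid (T : Finset ℝ≥0) : ∃ (N : ℕ) (τ : ℕ → ℝ≥0) (m : ℝ≥0 → ℕ), Monotone τ ∧ τ 0 = 0 ∧
    (∀ i, τ i ∈ insert 0 T) ∧ ∀ t ∈ T, m t ≤ N ∧ τ (m t) = t := by
  classical
  set S := insert 0 T with hS
  have hpos : 0 < S.card := Finset.card_pos.2 ⟨0, Finset.mem_insert_self 0 T⟩
  let e := S.orderEmbOfFin rfl
  have hex : ∀ t ∈ T, ∃ i : Fin S.card, e i = t := by
    intro t ht
    have : t ∈ Set.range e := by
      rw [Finset.range_orderEmbOfFin]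
      exact Finset.mem_insert_of_mem ht
    exact this
  -- The sorted times `insert 0 T` are continued as a constant beyond the last index.
  refine ⟨S.card - 1, fun i => e ⟨min i (S.card - 1), by omega⟩,
    fun t => if ht : t ∈ T then (hex t ht).choose else 0, ?_, ?_, ?_, ?_⟩
  · intro i j hij
    exact e.monotone (Fin.mk_le_mk.2 (min_le_min_right _ hij))
  · have h0 : (0 : ℝ≥0) ∈ Set.range e := by
      rw [Finset.range_orderEmbOfFin]
      exact Finset.mem_insert_self 0 T
    obtain ⟨i, hi⟩ := h0
    refine le_antisymm (hi ▸ e.monotone ?_) zero_le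
    rw [Fin.le_def]
    simp
  · exact fun i => Finset.orderEmbOfFin_mem _ _ _
  · intro t ht
    simp only [ht, dite_true]
    have h1 := (hex t ht).choose_spec
    have h2 := (hex t ht).choose.2
    refine ⟨by omega, Eq.trans (congrArg e (Fin.ext ?_)) h1⟩
    simp only
    omega

lemma sum_range_ite_sub {V : Type*} [AddCommGroup V] (g : ℕ → V) {m N : ℕ} (h : m ≤ N) :
    ∑ i ∈ Finset.range N, (if i < m then g (i + 1) - g i else 0) = g m - g 0 := by
  rw [← Finset.sum_range_sub, ← Finset.sum_filter]
  congr 1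
  ext i
  simp only [Finset.mem_filter, Finset.mem_range]
  omega

end Grid

/-! ### Algebra of step functions and their exponents. -/

namespace Step

variable {h h' : ℝ≥0}

lemma t_le (φ : Step h) {j : ℕ} (hj : j ≤ φ.n) : φ.t j ≤ h := (φ.mono hj).trans φ.le

/-- The times of two step functions. -/
def times (φ φ' : Step h) : Finset ℝ≥0 :=
  (Finset.range (φ.n + 1)).image φ.t ∪ (Finset.range (φ'.n + 1)).image φ'.t

lemma le_of_mem_times (φ φ' : Step h) {t : ℝ≥0} (ht : t ∈ insert 0 (times φ φ')) : t ≤ h := by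
  simp only [times, Finset.mem_insert, Finset.mem_union, Finset.mem_image, Finset.mem_range] at ht
  rcases ht with rfl | ⟨j, hj, rfl⟩ | ⟨j, hj, rfl⟩
  · exact zero_le
  · exact φ.t_le (by omega)
  · exact φ'.t_le (by omega)

/-- The weight of the `i`-th cell of a grid in a step function whose times have indices `m`. -/
def gridCoeff (φ : Step h) (m : ℝ≥0 → ℕ) (i : ℕ) : ℝ :=
  ∑ j ∈ Finset.range φ.n,
    φ.c j * ((if i < m (φ.t (j + 1)) then 1 else 0) - (if i < m (φ.t j) then 1 else 0))

/-- The increment of `Z` over `(t_j, t_{j+1}]` telescopes over the grid cells `i` with `m (t_j) ≤ i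
< m (t_{j+1})`; exchanging the two sums collects the weights cell by cell. -/
lemma sum_gridCoeff (φ : Step h) {N : ℕ} {τ : ℕ → ℝ≥0} {m : ℝ≥0 → ℕ}
    (hm : ∀ j ≤ φ.n, m (φ.t j) ≤ N ∧ τ (m (φ.t j)) = φ.t j)
    {Ω E : Type*} [NormedAddCommGroup E] [NormedSpace ℝ E] (Z : ℝ≥0 → Ω → E) (ω : Ω) :
    ∑ i ∈ Finset.range N, φ.gridCoeff m i • (Z (τ (i + 1)) ω - Z (τ i) ω) = φ.integral Z ω := by
  simp only [gridCoeff, integral, Finset.sum_smul]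
  rw [Finset.sum_comm]
  refine Finset.sum_congr rfl fun j hj => ?_
  have hj' := Finset.mem_range.1 hj
  simp only [mul_smul, ← Finset.smul_sum, sub_smul, ite_smul, one_smul, zero_smul,
    Finset.sum_sub_distrib]
  rw [sum_range_ite_sub (fun i => Z (τ i) ω) (hm _ (by omega)).1,
    sum_range_ite_sub (fun i => Z (τ i) ω) (hm _ (by omega)).1,
    (hm _ (by omega)).2, (hm _ (by omega)).2]
  simp

/-- The difference of two step functions, written on a common grid. -/
def sub (φ φ' : Step h) : Step h where
  n := (exists_grid (times φ φ')).choose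
  t := (exists_grid (times φ φ')).choose_spec.choose
  mono := (exists_grid (times φ φ')).choose_spec.choose_spec.choose_spec.1
  le := φ.le_of_mem_times φ'
    ((exists_grid (times φ φ')).choose_spec.choose_spec.choose_spec.2.2.1 _)
  c i := φ.gridCoeff (exists_grid (times φ φ')).choose_spec.choose_spec.choose i -
    φ'.gridCoeff (exists_grid (times φ φ')).choose_spec.choose_spec.choose i

lemma integral_sub (φ φ' : Step h) {Ω E : Type*} [NormedAddCommGroup E] [NormedSpace ℝ E]
    (Z : ℝ≥0 → Ω → E) (ω : Ω) :
    (φ.sub φ').integral Z ω = φ.integral Z ω - φ'.integral Z ω := by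
  have hg := (exists_grid (times φ φ')).choose_spec.choose_spec.choose_spec.2.2.2
  rw [← φ.sum_gridCoeff (fun j hj => hg _ (by
      refine Finset.mem_union_left _ (Finset.mem_image_of_mem _ (Finset.mem_range.2 (by omega)))))
    Z ω, ← φ'.sum_gridCoeff (fun j hj => hg _ (by
      refine Finset.mem_union_right _ (Finset.mem_image_of_mem _ (Finset.mem_range.2 (by omega)))))
    Z ω, ← Finset.sum_sub_distrib]
  simp only [← sub_smul]
  rfl

/-- The indicator of `(t_j, t_{j+1}]` at `s` is an increment of the path `t ↦ 1_{s ≤ t}`. Linearity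
of pointwise values thus becomes a case of linearity of integrals. -/
lemma toFun_eq_integral (φ : Step h) (s : ℝ≥0) :
    φ.toFun s = φ.integral (fun t (_ : Unit) => if s ≤ t then (1 : ℝ) else 0) () := by
  refine Finset.sum_congr rfl fun j _ => ?_
  have hj := φ.mono (Nat.le_succ j)
  by_cases h1 : s ≤ φ.t j
  · have h2 : s ≤ φ.t (j + 1) := h1.trans hj
    simp [h1, h2, Set.indicator]
  · by_cases h2 : s ≤ φ.t (j + 1)
    · simp [h1, h2, Set.indicator, not_le.1 h1]
    · simp [h1, h2, Set.indicator]

lemma toFun_sub (φ φ' : Step h) (s : ℝ≥0) : (φ.sub φ').toFun s = φ.toFun s - φ'.toFun s := by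
  simp only [toFun_eq_integral, integral_sub]

/-- A step function supported in `(0, h]` seen as a step function supported in `(0, h']`. -/
def up (φ : Step h) (hh : h ≤ h') : Step h' := { φ with le := φ.le.trans hh }

lemma toFun_up (φ : Step h) (hh : h ≤ h') (s : ℝ≥0) : (φ.up hh).toFun s = φ.toFun s := rfl

lemma integral_up (φ : Step h) (hh : h ≤ h') {Ω E : Type*} [NormedAddCommGroup E]
    [NormedSpace ℝ E] (Z : ℝ≥0 → Ω → E) : (φ.up hh).integral Z = φ.integral Z := rfl

lemma toFun_of_lt (φ : Step h) {s : ℝ≥0} (hs : h < s) : φ.toFun s = 0 := by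
  refine Finset.sum_eq_zero fun j hj => Set.indicator_of_notMem (fun hmem => ?_) _
  exact absurd (hmem.2.trans (φ.t_le (Finset.mem_range.1 hj))) (not_le.2 hs)

/-- The intervals are disjoint, so at most one term is nonzero; `G 0 = 0` covers the points outside
all of them. -/
lemma comp_toFun (φ : Step h) {V : Type*} [AddCommMonoid V] (G : ℝ → V) (hG : G 0 = 0) (s : ℝ≥0) :
    G (φ.toFun s) = ∑ j ∈ Finset.range φ.n,
      (Set.Ioc (φ.t j) (φ.t (j + 1))).indicator (fun _ => G (φ.c j)) s := by
  by_cases hex : ∃ j ∈ Finset.range φ.n, s ∈ Set.Ioc (φ.t j) (φ.t (j + 1))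
  · obtain ⟨j, hj, hs⟩ := hex
    have hne : ∀ k, k ≠ j → s ∉ Set.Ioc (φ.t k) (φ.t (k + 1)) := fun k hk hks =>
      Set.disjoint_left.1 (φ.mono.pairwise_disjoint_on_Ioc_succ hk) hks hs
    rw [toFun, Finset.sum_eq_single_of_mem j hj (fun k _ hk => Set.indicator_of_notMem (hne k hk) _),
      Finset.sum_eq_single_of_mem j hj (fun k _ hk => Set.indicator_of_notMem (hne k hk) _),
      Set.indicator_of_mem hs, Set.indicator_of_mem hs]
  · push Not at hex
    rw [toFun, Finset.sum_eq_zero (fun j hj => Set.indicator_of_notMem (hex j hj) _),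
      Finset.sum_eq_zero (fun j hj => Set.indicator_of_notMem (hex j hj) _), hG]

lemma measurable_toFun (φ : Step h) : Measurable φ.toFun :=
  Finset.measurable_sum _ fun _ _ => measurable_const.indicator measurableSet_Ioc

variable {E : Type*} [NormedAddCommGroup E] [InnerProductSpace ℝ E]

/-- The exponent `∫ Ψ(φ(s) u) ds` of the elementary integral of a step function. -/
def expo (φ : Step h) (Ψ : E → ℂ) (u : E) : ℂ :=
  ∑ j ∈ Finset.range φ.n, (((φ.t (j + 1) : ℝ) - φ.t j : ℝ) : ℂ) * Ψ (φ.c j • u)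

lemma expo_const_mul (φ : Step h) (Ψ : E → ℂ) (c : ℂ) (u : E) :
    φ.expo (fun v => c * Ψ v) u = c * φ.expo Ψ u := by
  simp only [expo, Finset.mul_sum]
  exact Finset.sum_congr rfl fun _ _ => by ring

lemma expo_eq_integral (φ : Step h) {Ψ : E → ℂ} (hΨ : Ψ 0 = 0) (u : E) :
    φ.expo Ψ u = ∫ s in Set.Ioc 0 (h : ℝ), Ψ (φ.toFun s.toNNReal • u) := by
  have hpt : ∀ s ∈ Set.Ioc 0 (h : ℝ), Ψ (φ.toFun s.toNNReal • u) = ∑ j ∈ Finset.range φ.n,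
      (Set.Ioc (φ.t j : ℝ) (φ.t (j + 1))).indicator (fun _ => Ψ (φ.c j • u)) s := by
    intro s hs
    rw [φ.comp_toFun (fun x => Ψ (x • u)) (by simpa using hΨ)]
    refine Finset.sum_congr rfl fun j _ => ?_
    have hmem : s.toNNReal ∈ Set.Ioc (φ.t j) (φ.t (j + 1)) ↔
        s ∈ Set.Ioc (φ.t j : ℝ) (φ.t (j + 1)) := by
      rw [Set.mem_Ioc, Set.mem_Ioc, Real.lt_toNNReal_iff_coe_lt, Real.toNNReal_le_iff_le_coe]
    by_cases hj : s ∈ Set.Ioc (φ.t j : ℝ) (φ.t (j + 1))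
    · rw [Set.indicator_of_mem hj, Set.indicator_of_mem (hmem.2 hj)]
    · rw [Set.indicator_of_notMem hj, Set.indicator_of_notMem (fun hc => hj (hmem.1 hc))]
  rw [setIntegral_congr_fun measurableSet_Ioc hpt, integral_finsetSum]
  · refine Finset.sum_congr rfl fun j hj => ?_
    have hj' := Finset.mem_range.1 hj
    have h1 : (φ.t j : ℝ) ≤ φ.t (j + 1) := φ.mono (Nat.le_succ j)
    have h2 : (φ.t (j + 1) : ℝ) ≤ h := φ.t_le hj'
    rw [setIntegral_indicator measurableSet_Ioc, Set.inter_eq_right.2, setIntegral_const]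
    · rw [Real.volume_real_Ioc_of_le h1, Complex.real_smul]
    · exact Set.Ioc_subset_Ioc (φ.t j).coe_nonneg h2
  · exact fun j _ => (integrable_const _).indicator measurableSet_Ioc

/-- The uniform bound keeps all values in the compact `[-C, C]`, where `x ↦ Ψ (x • u)` is bounded;
this supplies the dominating constant. -/
lemma tendsto_expo {ι : Type*} {l : Filter ι} [l.IsCountablyGenerated] {Ψ : E → ℂ}
    (hc : Continuous Ψ) (hΨ : Ψ 0 = 0) (φ : ι → Step h) {C : ℝ}
    (hC : ∀ i s, |(φ i).toFun s| ≤ C) {g : ℝ → ℝ}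
    (hg : ∀ᵐ s : ℝ, s ∈ Set.Ioc 0 (h : ℝ) →
      Tendsto (fun i => (φ i).toFun s.toNNReal) l (𝓝 (g s))) (u : E) :
    Tendsto (fun i => (φ i).expo Ψ u) l
      (𝓝 (∫ s in Set.Ioc 0 (h : ℝ), Ψ (g s • u))) := by
  have hcont : Continuous fun x : ℝ => Ψ (x • u) := by fun_prop
  obtain ⟨K, hK⟩ := (isCompact_Icc (a := -C) (b := C)).exists_bound_of_continuousOn
    hcont.continuousOn
  simp only [fun i => (φ i).expo_eq_integral hΨ u]
  refine tendsto_integral_filter_of_dominated_convergence (fun _ => K) ?_ ?_ (integrable_const K) ?_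
  · refine Eventually.of_forall fun i => ?_
    exact (hcont.measurable.comp
      ((φ i).measurable_toFun.comp measurable_real_toNNReal)).aestronglyMeasurable
  · exact Eventually.of_forall fun i => ae_of_all _ fun s => hK _ (abs_le.1 (hC i _))
  · rw [ae_restrict_iff' measurableSet_Ioc]
    filter_upwards [hg] with s hs hmem
    exact (hcont.tendsto _).comp (hs hmem)

lemma measurable_integral [MeasurableSpace E] [BorelSpace E] [SecondCountableTopology E]
    {Ω : Type*} [MeasurableSpace Ω] (φ : Step h)
    {Z : ℝ≥0 → Ω → E} (hZ : ∀ t, Measurable (Z t)) : Measurable (φ.integral Z) :=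
  Finset.measurable_sum _ fun _ _ => ((hZ _).sub (hZ _)).const_smul _

/-- The elementary integral of a step function as a measurable functional of the path. -/
lemma measurable_integral_path [MeasurableSpace E] [BorelSpace E] [SecondCountableTopology E]
    (φ : Step h) : Measurable fun g : ℝ≥0 → E => φ.integral (fun s (g : ℝ≥0 → E) => g s) g :=
  φ.measurable_integral fun t => measurable_pi_apply t

end Step

/-! ### Multiplicative functions on the half-line. -/

/-- Arbitrarily short integrals of a continuous function with value `1` at `0` do not vanish. -/
lemma exists_pos_integral_ne_zero {g : ℝ → ℂ} (hg : Continuous g) (h0 : g 0 = 1) :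
    ∃ δ : ℝ, 0 < δ ∧ ∫ x in (0 : ℝ)..δ, g x ≠ 0 := by
  have hd : HasDerivAt (fun t : ℝ => ∫ x in (0 : ℝ)..t, g x) (g 0) 0 :=
    intervalIntegral.integral_hasDerivAt_right (hg.intervalIntegrable _ _)
      (hg.stronglyMeasurableAtFilter _ _) hg.continuousAt
  have h1 : ∀ᶠ t in 𝓝[≠] (0 : ℝ), ∫ x in (0 : ℝ)..t, g x ≠ 0 := by
    have := hd.eventually_ne (c := 0) (by simp [h0])
    simpa using this
  have h2 : ∀ᶠ t in 𝓝[>] (0 : ℝ), ∫ x in (0 : ℝ)..t, g x ≠ 0 :=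
    h1.filter_mono (nhdsWithin_mono _ fun x hx => ne_of_gt hx)
  obtain ⟨δ, h3, h4⟩ := (h2.and self_mem_nhdsWithin).exists
  exact ⟨δ, h4, h3⟩

/-- A continuous multiplicative function on `[0, ∞)` is an exponential. -/
lemma exists_exponent_of_mul {g : ℝ → ℂ} (hg : Continuous g) (h0 : g 0 = 1)
    (hmul : ∀ s t, 0 ≤ s → 0 ≤ t → g (s + t) = g s * g t) :
    ∃ z : ℂ, ∀ t, 0 ≤ t → g t = Complex.exp (t * z) := by
  set F : ℝ → ℂ := fun t => ∫ x in (0 : ℝ)..t, g x with hF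
  have hFd : ∀ t, HasDerivAt F (g t) t := fun t =>
    intervalIntegral.integral_hasDerivAt_right (hg.intervalIntegrable _ _)
      (hg.stronglyMeasurableAtFilter _ _) hg.continuousAt
  obtain ⟨δ, hδ, hFδ⟩ : ∃ δ, 0 < δ ∧ F δ ≠ 0 := exists_pos_integral_ne_zero hg h0
  -- Integrating the functional equation over a window of length `δ` writes `g` as a difference of
  -- its primitive, so continuity already gives differentiability.
  have hshift : ∀ t, 0 ≤ t → g t = (F (t + δ) - F t) / F δ := by
    intro t ht
    rw [eq_div_iff hFδ]
    have h1 : F (t + δ) - F t = ∫ x in t..(t + δ), g x :=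
      intervalIntegral.integral_interval_sub_left (hg.intervalIntegrable _ _)
        (hg.intervalIntegrable _ _)
    have h2 : ∫ x in (0 : ℝ)..δ, g (t + x) = ∫ x in t..(t + δ), g x := by
      rw [intervalIntegral.integral_comp_add_left, add_zero]
    rw [h1, ← h2, hF, ← intervalIntegral.integral_const_mul]
    refine intervalIntegral.integral_congr fun x hx => ?_
    rw [Set.uIcc_of_le hδ.le] at hx
    exact (hmul t x ht hx.1).symm
  set z := (g δ - 1) / F δ with hz
  refine ⟨z, fun t ht => ?_⟩
  -- On `[0, ∞)` this is `g t * exp (-t z)`, with `g` replaced by the quotient of `hshift`, which is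
  -- differentiable on all of `ℝ`. Its derivative vanishes there since `g' = (g (· + δ) - g) / F δ =
  -- z g`.
  set k : ℝ → ℂ := fun t => (F (t + δ) - F t) / F δ * Complex.exp (-(t * z)) with hk
  have hkd : ∀ x, HasDerivAt k ((g (x + δ) - g x) / F δ * Complex.exp (-(x * z)) +
      (F (x + δ) - F x) / F δ * (Complex.exp (-(x * z)) * -(1 * z))) x := by
    intro x
    have h1 : HasDerivAt (fun t : ℝ => (F (t + δ) - F t) / F δ) ((g (x + δ) - g x) / F δ) x :=
      (((hFd (x + δ)).comp_add_const x δ).sub (hFd x)).div_const _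
    have h2 : HasDerivAt (fun t : ℝ => -((t : ℂ) * z)) (-(1 * z)) x :=
      ((Complex.ofRealCLM.hasDerivAt (x := x)).mul_const z).neg
    exact h1.mul h2.cexp
  have hconst := constant_of_has_deriv_right_zero (f := k) (a := 0) (b := t)
    (fun x _ => (hkd x).continuousAt.continuousWithinAt) (fun x hx => by
      have hx0 : 0 ≤ x := hx.1
      have := (hkd x).hasDerivWithinAt (s := Set.Ici x)
      convert this using 1
      rw [← hshift x hx0, hmul x δ hx0 hδ.le, hz]
      ring) t ⟨ht, le_rfl⟩
  simp only [hk] at hconst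
  rw [← hshift t ht, ← hshift 0 le_rfl, h0] at hconst
  simp only [Complex.ofReal_zero, zero_mul, neg_zero, Complex.exp_zero, mul_one] at hconst
  rw [Complex.exp_neg, ← div_eq_mul_inv, div_eq_iff (Complex.exp_ne_zero _), one_mul] at hconst
  exact hconst

/-- Recovers an exponent from its exponential without choosing a logarithm, and stays valid at `z =
0`. -/
lemma mul_integral_cexp (z : ℂ) (δ : ℝ) :
    z * ∫ x in (0 : ℝ)..δ, Complex.exp (x * z) = Complex.exp (δ * z) - 1 := by
  rw [← intervalIntegral.integral_const_mul]
  have h : ∀ x ∈ Set.uIcc 0 δ, HasDerivAt (fun x : ℝ => Complex.exp (x * z))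
      (z * Complex.exp (x * z)) x := by
    intro x _
    have h2 : HasDerivAt (fun t : ℝ => (t : ℂ) * z) (1 * z) x :=
      (Complex.ofRealCLM.hasDerivAt (x := x)).mul_const z
    have := h2.cexp
    convert this using 1
    ring
  rw [intervalIntegral.integral_eq_sub_of_hasDerivAt h
    ((by fun_prop : Continuous fun x : ℝ => z * Complex.exp (x * z)).intervalIntegrable _ _)]
  simp

/-! ### The characteristic exponent of a Lévy process. -/

section Exponent

variable {Ω : Type*} [MeasurableSpace Ω] {P : Measure Ω}
  {E : Type*} [NormedAddCommGroup E] [InnerProductSpace ℝ E]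
  [MeasurableSpace E]

/-- `W` starts at `0` and has independent stationary increments, with characteristic exponent
`κ`. -/
structure HasExponent (W : ℝ≥0 → Ω → E) (P : Measure Ω) (κ : E → ℂ) : Prop where
  measurable : ∀ t, Measurable (W t)
  start : ∀ᵐ ω ∂P, W 0 ω = 0
  ch_eq : ∀ (n : ℕ) (t : ℕ → ℝ≥0), Monotone t → ∀ u : ℕ → E,
    ch P (fun ω => ∑ j ∈ Finset.range n, ⟪W (t (j + 1)) ω - W (t j) ω, u j⟫_ℝ) =
      Complex.exp (∑ j ∈ Finset.range n, (((t (j + 1) : ℝ) - t j : ℝ) : ℂ) * κ (u j))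

lemma HasExponent.ch_sub {W : ℝ≥0 → Ω → E} {κ : E → ℂ} (hW : HasExponent W P κ) {s t : ℝ≥0}
    (hst : s ≤ t) (u : E) : ch P (fun ω => ⟪W t ω - W s ω, u⟫_ℝ) =
      Complex.exp (((t : ℝ) - s : ℝ) * κ u) := by
  have hm : Monotone fun j : ℕ => if j = 0 then s else t := by
    intro i j hij
    by_cases hi : i = 0
    · by_cases hj : j = 0 <;> simp [hi, hj, hst]
    · simp [hi, show j ≠ 0 by omega]
  simpa using hW.ch_eq 1 _ hm (fun _ => u)

lemma HasExponent.ch_eval {W : ℝ≥0 → Ω → E} {κ : E → ℂ} (hW : HasExponent W P κ) (t : ℝ≥0)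
    (u : E) : ch P (fun ω => ⟪W t ω, u⟫_ℝ) = Complex.exp ((t : ℝ) * κ u) := by
  have h := hW.ch_sub (s := 0) (t := t) zero_le u
  rw [NNReal.coe_zero, sub_zero] at h
  rw [← h]
  refine ch_congr ?_
  filter_upwards [hW.start] with ω hω
  rw [hω, sub_zero]

/-- Time change by a constant factor. -/
lemma HasExponent.comp_mul {W : ℝ≥0 → Ω → E} {κ : E → ℂ} (hW : HasExponent W P κ) (c : ℝ≥0) :
    HasExponent (fun t => W (c * t)) P (fun u => (c : ℂ) * κ u) where
  measurable t := hW.measurable _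
  start := by simpa using hW.start
  ch_eq n t ht u := by
    rw [hW.ch_eq n (fun j => c * t j) (fun i j hij => mul_le_mul_right (ht hij) c) u]
    congr 1
    refine Finset.sum_congr rfl fun j _ => ?_
    push_cast
    ring

variable [BorelSpace E] [FiniteDimensional ℝ E]

/-- For fixed `u` the characteristic function is continuous in `t` by stochastic continuity and
multiplicative by independence and stationarity, hence `exp(t ψ(u))`. The joint formula follows by
splitting off the last increment. -/
theorem IsLevyInLaw.exists_hasExponent [IsProbabilityMeasure P] {Z : ℝ≥0 → Ω → E}
    (hZ : IsLevyInLaw Z P) :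
    ∃ ψ : E → ℂ, Continuous ψ ∧ ψ 0 = 0 ∧ HasExponent Z P ψ := by
  have hsc : SecondCountableTopology E :=
    have := FiniteDimensional.proper_real E; inferInstance
  set Φ : ℝ → E → ℂ := fun t u => ch P (fun ω => ⟪Z t.toNNReal ω, u⟫_ℝ) with hΦ
  have hmeas : ∀ s u, Measurable fun ω => ⟪Z s ω, u⟫_ℝ := fun s u =>
    (hZ.measurable s).inner measurable_const
  have hincr : ∀ s t : ℝ≥0, s ≤ t → ∀ u,
      ch P (fun ω => ⟪Z t ω - Z s ω, u⟫_ℝ) = Φ ((t : ℝ) - s) u := by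
    intro s t hst u
    have h1 := (hZ.stationary s (t - s)).comp
      (u := fun x => ⟪x, u⟫_ℝ) (by fun_prop)
    rw [add_tsub_cancel_of_le hst] at h1
    have h2 := ch_identDistrib h1
    simp only [Function.comp_def] at h2
    rw [h2, hΦ]
    simp only
    rw [← NNReal.coe_sub hst, Real.toNNReal_coe]
    refine ch_congr ?_
    filter_upwards [hZ.start] with ω hω
    rw [hω, sub_zero]
  have h0 : ∀ u, Φ 0 u = 1 := by
    intro u
    have := hincr 0 0 le_rfl u
    simp only [sub_self, inner_zero_left] at this
    rw [← this, ch_zero]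
  have hct : ∀ u, Continuous fun t => Φ t u := by
    intro u
    refine Continuous.comp (g := fun t : ℝ≥0 => ch P (fun ω => ⟪Z t ω, u⟫_ℝ)) ?_
      continuous_real_toNNReal
    refine continuous_iff_continuousAt.2 fun t => ?_
    exact tendsto_ch (fun s => (hmeas s u).aemeasurable) (hmeas t u).aemeasurable
      (tendstoInMeasure_inner (hZ.stochContinuous t) u)
  have hcu : ∀ t, Continuous (Φ t) := by
    intro t
    have : IsProbabilityMeasure (P.map (Z t.toNNReal)) :=
      Measure.isProbabilityMeasure_map (hZ.measurable _).aemeasurable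
    have h := continuous_charFun (μ := P.map (Z t.toNNReal))
    refine h.congr fun u => ?_
    rw [charFun_map_eq_ch (hZ.measurable _).aemeasurable]
  have hmul : ∀ u s t, 0 ≤ s → 0 ≤ t → Φ (s + t) u = Φ s u * Φ t u := by
    intro u s t hs ht
    lift s to ℝ≥0 using hs
    lift t to ℝ≥0 using ht
    have hind := hZ.indep.indepFun_sub_sub (zero_le : 0 ≤ s) (le_self_add : s ≤ s + t)
    have hm : Measurable fun x : E => ⟪x, u⟫_ℝ := by fun_prop
    have h1 := ch_add_of_indepFun
      (hm.comp ((hZ.measurable s).sub (hZ.measurable 0))).aemeasurable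
      (hm.comp ((hZ.measurable (s + t)).sub (hZ.measurable s))).aemeasurable
      (hind.comp hm hm)
    simp only [Function.comp_def, Pi.sub_apply, ← inner_add_left] at h1
    have hadd : ∀ ω, Z s ω - Z 0 ω + (Z (s + t) ω - Z s ω) = Z (s + t) ω - Z 0 ω := fun ω => by
      abel
    simp only [hadd] at h1
    rw [hincr 0 _ zero_le, hincr 0 _ zero_le, hincr _ _ le_self_add] at h1
    simpa using h1
  choose ψ hψ using fun u => exists_exponent_of_mul (hct u) (h0 u) (hmul u)
  have hform : ∀ u δ, 0 ≤ δ → ψ u * ∫ x in (0 : ℝ)..δ, Φ x u = Φ δ u - 1 := by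
    intro u δ hδ
    rw [hψ u δ hδ, ← mul_integral_cexp]
    congr 1
    refine intervalIntegral.integral_congr fun x hx => ?_
    rw [Set.uIcc_of_le hδ] at hx
    exact hψ u x hx.1
  have hΦbd : ∀ t u, ‖Φ t u‖ ≤ 1 := fun t u => norm_ch_le _
  have hFcont : ∀ δ, Continuous fun u => ∫ x in (0 : ℝ)..δ, Φ x u := fun δ =>
    intervalIntegral.continuous_of_dominated_interval (bound := fun _ => 1)
      (fun u => (hct u).aestronglyMeasurable) (fun u => ae_of_all _ fun t _ => hΦbd t u)
      (by simp) (ae_of_all _ fun t _ => hcu t)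
  refine ⟨ψ, continuous_iff_continuousAt.2 fun u => ?_, ?_, hZ.measurable, hZ.start, ?_⟩
  -- Near `u`, `hform` expresses `ψ` as the quotient of `Φ δ - 1` by `∫_0^δ Φ`, both continuous in
  -- the second variable, with `δ` chosen so that the denominator is nonzero at `u`.
  · obtain ⟨δ, hδ, hFδ⟩ := exists_pos_integral_ne_zero (hct u) (h0 u)
    have hne : ∀ᶠ v in 𝓝 u, ∫ x in (0 : ℝ)..δ, Φ x v ≠ 0 :=
      (hFcont δ).continuousAt.eventually_ne hFδ
    have heq : (fun v => (Φ δ v - 1) / ∫ x in (0 : ℝ)..δ, Φ x v) =ᶠ[𝓝 u] ψ := by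
      filter_upwards [hne] with v hv
      rw [← hform v δ hδ.le, mul_div_cancel_right₀ _ hv]
    refine ContinuousAt.congr ?_ heq
    exact ((hcu δ).continuousAt.sub continuousAt_const).div (hFcont δ).continuousAt hFδ
  · have h1 : ∀ x, Φ x 0 = 1 := fun x => by simp [hΦ, ch]
    have := hform 0 1 zero_le_one
    simpa [h1] using this
  · intro n t ht u
    have hind : iIndepFun (fun j ω => ⟪Z (t (j + 1)) ω - Z (t j) ω, u j⟫_ℝ) P :=
      (hZ.indep.nat ht).comp (fun j x => ⟪x, u j⟫_ℝ) (fun j => by fun_prop)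
    have hm : ∀ j, Measurable fun ω => ⟪Z (t (j + 1)) ω - Z (t j) ω, u j⟫_ℝ := fun j =>
      ((hZ.measurable _).sub (hZ.measurable _)).inner measurable_const
    induction n with
    | zero => simp [ch_zero]
    | succ n ih =>
      simp only [Finset.sum_range_succ]
      have hI := hind.indepFun_finsetSum_of_notMem (s := Finset.range n) (i := n) hm (by simp)
      rw [ch_add_of_indepFun (Finset.measurable_sum _ fun j _ => hm j).aemeasurable
        (hm n).aemeasurable (by simpa [Finset.sum_fn] using hI), ih, Complex.exp_add,
        hincr _ _ (ht (Nat.le_succ n)), hψ]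
      exact sub_nonneg.2 (ht (Nat.le_succ n))

end Exponent

/-! ### Convergence of exponents from convergence of their exponentials. -/

/-- If the exponentials of the increments of a continuous function tend to `1` at infinity, then
the function has a limit at infinity. -/
lemma exists_tendsto_of_cexp_sub {G : ℝ≥0 → ℂ} (hG : Continuous G)
    (h : ∀ ε : ℝ, 0 < ε → ∃ A, ∀ b, A ≤ b → ‖Complex.exp (G b - G A) - 1‖ < ε) :
    ∃ z, Tendsto G atTop (𝓝 z) := by
  refine cauchySeq_tendsto_of_complete (Metric.cauchySeq_iff'.2 fun ε hε => ?_)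
  -- If `G` ever moved by `ε` from `G A`, by continuity it would at some point be at distance
  -- exactly `r`. There `|e^w - 1 - w| ≤ |w|²` gives `|e^w - 1| ≥ r - r²`, contradicting the choice
  -- of `A`; `r ≤ 1/2` makes this threshold positive.
  obtain ⟨r, hr0, hrε, hr⟩ : ∃ r : ℝ, 0 < r ∧ r ≤ ε ∧ r ≤ 1 / 2 :=
    ⟨min ε (1 / 2), by positivity, min_le_left _ _, min_le_right _ _⟩
  obtain ⟨A, hA⟩ := h (r - r ^ 2) (by nlinarith)
  refine ⟨A, fun b hb => ?_⟩
  rw [dist_eq_norm]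
  by_contra! hcon
  have hcont : ContinuousOn (fun x => ‖G x - G A‖) (Set.Icc A b) := by fun_prop
  have hmem : r ∈ Set.Icc ‖G A - G A‖ ‖G b - G A‖ := ⟨by simpa using hr0.le, hrε.trans hcon⟩
  obtain ⟨x, hx, hxr⟩ := intermediate_value_Icc hb hcont hmem
  have h1 := hA x hx.1
  simp only at hxr
  have h2 := Complex.norm_exp_sub_one_sub_id_le (x := G x - G A) (by rw [hxr]; linarith)
  rw [hxr] at h2
  have h3 := norm_sub_norm_le (G x - G A) (-(Complex.exp (G x - G A) - 1 - (G x - G A)))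
  rw [sub_neg_eq_add, add_sub_cancel, norm_neg, hxr] at h3
  linarith

/-! ### Integrals against one process. -/

section Single

variable {Ω : Type*} [MeasurableSpace Ω] {P : Measure Ω}
  {E : Type*} [NormedAddCommGroup E] [InnerProductSpace ℝ E] {f : ℝ≥0 → ℝ}

/-- `φ` is a uniformly bounded sequence of step functions converging to `f` almost everywhere on
`(0, h]`. -/
structure IsApprox (f : ℝ≥0 → ℝ) (h : ℝ≥0) (φ : ℕ → Step h) : Prop where
  bound : ∃ C : ℝ, ∀ k s, |(φ k).toFun s| ≤ C
  tendsto : ∀ᵐ s : ℝ, s ∈ Set.Ioc 0 (h : ℝ) →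
    Tendsto (fun k => (φ k).toFun s.toNNReal) atTop (𝓝 (f s.toNNReal))

lemma tendsto_fst_snd {α β : Type*} {l : Filter α} {l' : Filter β} {x y : ℝ} {F : α → ℝ}
    {F' : β → ℝ} (hF : Tendsto F l (𝓝 x)) (hF' : Tendsto F' l' (𝓝 y)) :
    Tendsto (fun p : α × β => F p.1 - F' p.2) (l ×ˢ l') (𝓝 (x - y)) :=
  (hF.comp tendsto_fst).sub (hF'.comp tendsto_snd)

/-- On `(0, a]` both sequences tend to `f` and cancel; on `(a, b]` the first is zero and only `f`
remains. The two indices run independently, so that `a = b` yields a Cauchy property. -/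
lemma IsApprox.tendsto_expo_sub_up {a b : ℝ≥0} (hab : a ≤ b) {φ : ℕ → Step a} {φ' : ℕ → Step b}
    (hφ : IsApprox f a φ) (hφ' : IsApprox f b φ') {Ψ : E → ℂ} (hc : Continuous Ψ) (hΨ : Ψ 0 = 0)
    (u : E) :
    Tendsto (fun p : ℕ × ℕ => ((φ' p.1).sub ((φ p.2).up hab)).expo Ψ u) (atTop ×ˢ atTop)
      (𝓝 (∫ s in Set.Ioc (a : ℝ) b, Ψ (f s.toNNReal • u))) := by
  obtain ⟨C, hC⟩ := hφ.bound
  obtain ⟨C', hC'⟩ := hφ'.bound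
  have hint : ∫ s in Set.Ioc (a : ℝ) b, Ψ (f s.toNNReal • u) =
      ∫ s in Set.Ioc (0 : ℝ) b, Ψ ((Set.Ioc (a : ℝ) b).indicator (fun s => f s.toNNReal) s • u) := by
    have hpt : ∀ s, Ψ ((Set.Ioc (a : ℝ) b).indicator (fun s => f s.toNNReal) s • u) =
        (Set.Ioc (a : ℝ) b).indicator (fun s => Ψ (f s.toNNReal • u)) s := by
      intro s
      by_cases hs : s ∈ Set.Ioc (a : ℝ) b
      · rw [Set.indicator_of_mem hs, Set.indicator_of_mem hs]
      · rw [Set.indicator_of_notMem hs, Set.indicator_of_notMem hs, zero_smul, hΨ]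
    simp only [hpt]
    rw [setIntegral_indicator measurableSet_Ioc, Set.inter_eq_right.2
      (Set.Ioc_subset_Ioc_left a.coe_nonneg)]
  rw [hint]
  refine Step.tendsto_expo hc hΨ _ (C := C' + C) (fun p s => ?_) ?_ u
  · rw [Step.toFun_sub, Step.toFun_up]
    exact (abs_sub _ _).trans (add_le_add (hC' _ _) (hC _ _))
  · filter_upwards [hφ.tendsto, hφ'.tendsto] with s h1 h2 hs
    simp only [Step.toFun_sub, Step.toFun_up]
    by_cases hsa : s ≤ a
    · rw [Set.indicator_of_notMem (fun hmem => absurd hmem.1 (not_lt.2 hsa))]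
      simpa using tendsto_fst_snd (h2 hs) (h1 (Set.mem_Ioc.2 ⟨hs.1, hsa⟩))
    · rw [not_le] at hsa
      rw [Set.indicator_of_mem (Set.mem_Ioc.2 ⟨hsa, hs.2⟩)]
      have hz : ∀ k, (φ k).toFun s.toNNReal = 0 := fun k =>
        (φ k).toFun_of_lt (Real.lt_toNNReal_iff_coe_lt.2 hsa)
      simp only [hz, sub_zero]
      exact (h2 hs).comp tendsto_fst

lemma IsApprox.tendsto_expo {h : ℝ≥0} {φ : ℕ → Step h} (hφ : IsApprox f h φ) {Ψ : E → ℂ}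
    (hc : Continuous Ψ) (hΨ : Ψ 0 = 0) (u : E) :
    Tendsto (fun k => (φ k).expo Ψ u) atTop
      (𝓝 (∫ s in Set.Ioc (0 : ℝ) h, Ψ (f s.toNNReal • u))) := by
  obtain ⟨C, hC⟩ := hφ.bound
  exact Step.tendsto_expo hc hΨ φ hC hφ.tendsto u

lemma IsApprox.tendsto_expo_sub {h : ℝ≥0} {φ φ' : ℕ → Step h}
    (hφ : IsApprox f h φ) (hφ' : IsApprox f h φ') {Ψ : E → ℂ} (hc : Continuous Ψ) (hΨ : Ψ 0 = 0)
    (u : E) :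
    Tendsto (fun p : ℕ × ℕ => ((φ' p.1).sub (φ p.2)).expo Ψ u) (atTop ×ˢ atTop) (𝓝 0) := by
  have := IsApprox.tendsto_expo_sub_up le_rfl hφ hφ' hc hΨ u
  rwa [Set.Ioc_self, Measure.restrict_empty, integral_zero_measure] at this

/-- Measurability of `f` is read off from its step approximations. -/
lemma IsApprox.aestronglyMeasurable {h : ℝ≥0} {φ : ℕ → Step h} (hφ : IsApprox f h φ) :
    AEStronglyMeasurable (fun s : ℝ => f s.toNNReal) (volume.restrict (Set.Ioc 0 (h : ℝ))) :=
  aestronglyMeasurable_of_tendsto_ae atTop (f := fun k (s : ℝ) => (φ k).toFun s.toNNReal)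
    (fun k => ((φ k).measurable_toFun.comp measurable_real_toNNReal).aestronglyMeasurable)
    ((ae_restrict_iff' measurableSet_Ioc).2 hφ.tendsto)

lemma integrableOn_comp {h : ℝ≥0} {φ : ℕ → Step h} (hφ : IsApprox f h φ)
    (hf : ∃ C : ℝ, ∀ s ≤ h, |f s| ≤ C) {Ψ : E → ℂ} (hc : Continuous Ψ) (u : E) :
    IntegrableOn (fun s : ℝ => Ψ (f s.toNNReal • u)) (Set.Ioc 0 (h : ℝ)) := by
  have hcont : Continuous fun x : ℝ => Ψ (x • u) := by fun_prop
  obtain ⟨C, hC⟩ := hf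
  obtain ⟨K, hK⟩ := (isCompact_Icc (a := -C) (b := C)).exists_bound_of_continuousOn
    hcont.continuousOn
  refine Integrable.of_bound (hcont.comp_aestronglyMeasurable hφ.aestronglyMeasurable) K ?_
  rw [ae_restrict_iff' measurableSet_Ioc]
  refine ae_of_all _ fun s hs => hK _ (abs_le.1 (hC _ ?_))
  exact Real.toNNReal_le_iff_le_coe.2 hs.2

lemma setIntegral_Ioc_eq_sub (hφ : ∀ h, ∃ φ, IsApprox f h φ)
    (hf : ∀ h : ℝ≥0, ∃ C : ℝ, ∀ s ≤ h, |f s| ≤ C) {Ψ : E → ℂ} (hc : Continuous Ψ) (u : E)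
    {a b : ℝ≥0} (hab : a ≤ b) :
    ∫ s in Set.Ioc (a : ℝ) b, Ψ (f s.toNNReal • u) =
      (∫ s in Set.Ioc (0 : ℝ) b, Ψ (f s.toNNReal • u)) -
        ∫ s in Set.Ioc (0 : ℝ) a, Ψ (f s.toNNReal • u) := by
  have hI : ∀ c : ℝ≥0, IntervalIntegrable (fun s : ℝ => Ψ (f s.toNNReal • u)) volume 0 c :=
    fun c => (intervalIntegrable_iff_integrableOn_Ioc_of_le c.coe_nonneg).2
      (integrableOn_comp (hφ c).choose_spec (hf c) hc u)
  rw [← intervalIntegral.integral_of_le (NNReal.coe_le_coe.2 hab),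
    ← intervalIntegral.integral_of_le a.coe_nonneg, ← intervalIntegral.integral_of_le b.coe_nonneg,
    intervalIntegral.integral_interval_sub_left (hI b) (hI a)]

lemma continuous_setIntegral_Ioc (hφ : ∀ h, ∃ φ, IsApprox f h φ)
    (hf : ∀ h : ℝ≥0, ∃ C : ℝ, ∀ s ≤ h, |f s| ≤ C) {Ψ : E → ℂ} (hc : Continuous Ψ) (u : E) :
    Continuous fun h : ℝ≥0 => ∫ s in Set.Ioc (0 : ℝ) h, Ψ (f s.toNNReal • u) := by
  -- Cutting off at `0` makes the integrand integrable on every real interval, so that its primitive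
  -- is continuous on the whole line.
  set q : ℝ → ℂ := (Set.Ioi 0).indicator fun s : ℝ => Ψ (f s.toNNReal • u) with hq
  have hq0 : ∀ c : ℝ, IntervalIntegrable q volume 0 c := by
    intro c
    rcases le_total 0 c with h0 | h0
    · lift c to ℝ≥0 using h0
      rw [intervalIntegrable_iff_integrableOn_Ioc_of_le c.coe_nonneg]
      exact (integrableOn_comp (hφ c).choose_spec (hf c) hc u).indicator measurableSet_Ioi
    · refine (intervalIntegrable_const (c := (0 : ℂ))).congr fun s hs => ?_
      rw [Set.uIoc_of_ge h0] at hs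
      exact (Set.indicator_of_notMem (not_lt.2 hs.2) _).symm
  have h1 : Continuous fun c : ℝ => ∫ s in (0 : ℝ)..c, q s :=
    intervalIntegral.continuous_primitive (fun a b => (hq0 a).symm.trans (hq0 b)) 0
  refine (h1.comp NNReal.continuous_coe).congr fun h => ?_
  simp only [Function.comp_apply]
  rw [intervalIntegral.integral_of_le h.coe_nonneg]
  exact setIntegral_congr_fun measurableSet_Ioc fun s hs => Set.indicator_of_mem (by exact hs.1) _

variable [MeasurableSpace E]

/-- The elementary integrals of `Z` have characteristic exponent `∫ Ψ(φ(s) u) ds`. -/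
structure StepExponent (Z : ℝ≥0 → Ω → E) (P : Measure Ω) (Ψ : E → ℂ) : Prop where
  measurable : ∀ t, Measurable (Z t)
  ch_integral : ∀ {h : ℝ≥0} (φ : Step h) (u : E),
    ch P (fun ω => ⟪φ.integral Z ω, u⟫_ℝ) = Complex.exp (φ.expo Ψ u)

lemma HasExponent.stepExponent {Z : ℝ≥0 → Ω → E} {Ψ : E → ℂ} (hZ : HasExponent Z P Ψ) :
    StepExponent Z P Ψ where
  measurable := hZ.measurable
  ch_integral φ u := by
    rw [Step.expo, ← hZ.ch_eq φ.n φ.t φ.mono (fun j => φ.c j • u)]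
    congr 1
    ext ω
    rw [Step.integral, sum_inner]
    exact Finset.sum_congr rfl fun j _ => by rw [real_inner_smul_left, real_inner_smul_right]

lemma hasIntegral_iff {Z : ℝ≥0 → Ω → E} {h : ℝ≥0} {I : Ω → E} :
    HasIntegral f Z P h I ↔ Measurable I ∧ ∃ φ, IsApprox f h φ ∧
      TendstoInMeasure P (fun k => (φ k).integral Z) atTop I :=
  ⟨fun ⟨hI, φ, h1, h2, h3⟩ => ⟨hI, φ, ⟨h1, h2⟩, h3⟩,
    fun ⟨hI, φ, ⟨h1, h2⟩, h3⟩ => ⟨hI, φ, h1, h2, h3⟩⟩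

variable [BorelSpace E] [FiniteDimensional ℝ E]

/-- The difference is the integral of a single step function, whose exponent tends to `0`. The
diagonal shows that the integral does not depend on the approximating sequence; `φ = φ'` shows that
it exists. -/
lemma StepExponent.tendstoInMeasure_sub [IsProbabilityMeasure P] {Z : ℝ≥0 → Ω → E} {Ψ : E → ℂ}
    (hZ : StepExponent Z P Ψ) (hc : Continuous Ψ) (hΨ : Ψ 0 = 0) {h : ℝ≥0} {φ φ' : ℕ → Step h}
    (hφ : IsApprox f h φ) (hφ' : IsApprox f h φ') :
    TendstoInMeasure P (fun (p : ℕ × ℕ) ω => (φ' p.1).integral Z ω - (φ p.2).integral Z ω)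
      (atTop ×ˢ atTop) (fun _ => 0) := by
  have hsc : SecondCountableTopology E :=
    have := FiniteDimensional.proper_real E; inferInstance
  refine tendstoInMeasure_zero_of_tendsto_ch (fun p => ((φ' p.1).measurable_integral
    hZ.measurable).sub ((φ p.2).measurable_integral hZ.measurable)) fun u => ?_
  simp only [← Step.integral_sub, hZ.ch_integral]
  have := (hφ.tendsto_expo_sub hφ' hc hΨ u).cexp
  rwa [Complex.exp_zero] at this

/-- The stochastic integral is the limit along any approximating sequence. -/
lemma HasIntegral.tendstoInMeasure [IsProbabilityMeasure P] {Z : ℝ≥0 → Ω → E} {Ψ : E → ℂ}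
    (hZ : StepExponent Z P Ψ) (hc : Continuous Ψ) (hΨ : Ψ 0 = 0) {h : ℝ≥0} {φ : ℕ → Step h}
    (hφ : IsApprox f h φ) {I : Ω → E} (hI : HasIntegral f Z P h I) :
    TendstoInMeasure P (fun k => (φ k).integral Z) atTop I := by
  obtain ⟨_, φ', hφ', hI'⟩ := hasIntegral_iff.1 hI
  refine tendstoInMeasure_of_sub ?_ hI'
  exact (hZ.tendstoInMeasure_sub hc hΨ hφ' hφ).comp (ns := fun k : ℕ => (k, k))
    (tendsto_id.prodMk tendsto_id)

lemma ch_sub_of_hasIntegral [IsProbabilityMeasure P] {Z : ℝ≥0 → Ω → E} {Ψ : E → ℂ}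
    (hZ : StepExponent Z P Ψ) (hc : Continuous Ψ) (hΨ : Ψ 0 = 0) {a b : ℝ≥0} (hab : a ≤ b)
    {I J : Ω → E} (hI : HasIntegral f Z P a I) (hJ : HasIntegral f Z P b J) (u : E) :
    ch P (fun ω => ⟪J ω - I ω, u⟫_ℝ) =
      Complex.exp (∫ s in Set.Ioc (a : ℝ) b, Ψ (f s.toNNReal • u)) := by
  have hsc : SecondCountableTopology E :=
    have := FiniteDimensional.proper_real E; inferInstance
  obtain ⟨hIm, φ, hφ, hI'⟩ := hasIntegral_iff.1 hI
  obtain ⟨hJm, φ', hφ', hJ'⟩ := hasIntegral_iff.1 hJ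
  have h1 := tendsto_ch_inner (X := fun k ω => (φ' k).integral Z ω - (φ k).integral Z ω)
    (fun k => ((φ' k).measurable_integral hZ.measurable).sub
      ((φ k).measurable_integral hZ.measurable)) (hJm.sub hIm) (tendstoInMeasure_sub hJ' hI') u
  have h2 : Tendsto (fun k => Complex.exp (((φ' k).sub ((φ k).up hab)).expo Ψ u)) atTop _ :=
    ((IsApprox.tendsto_expo_sub_up hab hφ hφ' hc hΨ u).comp
      (tendsto_id.prodMk tendsto_id)).cexp
  refine tendsto_nhds_unique h1 (h2.congr fun k => ?_)
  rw [← hZ.ch_integral]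
  simp only [Step.integral_sub, Step.integral_up]

/-- If the improper integral exists, the integrated exponents converge. -/
theorem HasImproperIntegral.exists_tendsto_exponent [IsProbabilityMeasure P] {Z : ℝ≥0 → Ω → E}
    {Ψ : E → ℂ} (hZ : StepExponent Z P Ψ) (hc : Continuous Ψ) (hΨ : Ψ 0 = 0)
    (hf : ∀ h : ℝ≥0, ∃ C : ℝ, ∀ s ≤ h, |f s| ≤ C) {I : Ω → E}
    (hI : HasImproperIntegral f Z P I) :
    ∃ κ : E → ℂ, ∀ u, Tendsto (fun h : ℝ≥0 => ∫ s in Set.Ioc (0 : ℝ) h, Ψ (f s.toNNReal • u))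
      atTop (𝓝 (κ u)) := by
  have hsc : SecondCountableTopology E :=
    have := FiniteDimensional.proper_real E; inferInstance
  obtain ⟨hIm, J, hJ, hJI⟩ := hI
  have hφ : ∀ h, ∃ φ, IsApprox f h φ := fun h =>
    let ⟨_, φ, hφ, _⟩ := hasIntegral_iff.1 (hJ h); ⟨φ, hφ⟩
  have hex : ∀ u, ∃ z, Tendsto (fun h : ℝ≥0 => ∫ s in Set.Ioc (0 : ℝ) h, Ψ (f s.toNNReal • u))
      atTop (𝓝 z) := by
    intro u
    refine exists_tendsto_of_cexp_sub (continuous_setIntegral_Ioc hφ hf hc u) fun ε hε => ?_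
    have h1 : TendstoInMeasure P (fun (p : ℝ≥0 × ℝ≥0) ω => J p.1 ω - J p.2 ω)
        (atTop ×ˢ atTop) (fun ω => I ω - I ω) :=
      tendstoInMeasure_sub (hJI.comp tendsto_fst) (hJI.comp tendsto_snd)
    have h2 := tendsto_ch_inner (X := fun (p : ℝ≥0 × ℝ≥0) ω => J p.1 ω - J p.2 ω)
      (Y := fun ω => I ω - I ω) (fun p => (hJ p.1).1.sub (hJ p.2).1) (hIm.sub hIm) h1 u
    simp only [sub_self, inner_zero_left, ch_zero] at h2
    have h3 := Metric.tendsto_nhds.1 h2 ε hε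
    rw [prod_atTop_atTop_eq] at h3
    obtain ⟨⟨A, B⟩, hAB⟩ := eventually_atTop.1 h3
    -- One base point has to serve every later `b`, so it must exceed both thresholds.
    refine ⟨max A B, fun b hb => ?_⟩
    have h4 := hAB (b, max A B) ⟨(le_max_left _ _).trans hb, le_max_right _ _⟩
    rwa [dist_eq_norm, ch_sub_of_hasIntegral hZ hc hΨ hb (hJ (max A B)) (hJ b) u,
      setIntegral_Ioc_eq_sub hφ hf hc u hb] at h4
  exact ⟨fun u => (hex u).choose, fun u => (hex u).choose_spec⟩

/-- The characteristic function of the improper integral. -/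
lemma HasImproperIntegral.ch_eq [IsProbabilityMeasure P] {Z : ℝ≥0 → Ω → E}
    {Ψ κ : E → ℂ} (hZ : StepExponent Z P Ψ) (hc : Continuous Ψ) (hΨ : Ψ 0 = 0)
    (hκ : ∀ u, Tendsto (fun h : ℝ≥0 => ∫ s in Set.Ioc (0 : ℝ) h, Ψ (f s.toNNReal • u))
      atTop (𝓝 (κ u))) {I : Ω → E} (hI : HasImproperIntegral f Z P I) (u : E) :
    ch P (fun ω => ⟪I ω, u⟫_ℝ) = Complex.exp (κ u) := by
  have hsc : SecondCountableTopology E :=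
    have := FiniteDimensional.proper_real E; inferInstance
  obtain ⟨hIm, J, hJ, hJI⟩ := hI
  have h1 := tendsto_ch_inner (fun h => (hJ h).1) hIm hJI u
  refine tendsto_nhds_unique h1 ((hκ u).cexp.congr fun h => ?_)
  obtain ⟨hJm, φ, hφ, hJ'⟩ := hasIntegral_iff.1 (hJ h)
  have h2 := tendsto_ch_inner (fun k => (φ k).measurable_integral hZ.measurable) hJm hJ' u
  refine tendsto_nhds_unique ((hφ.tendsto_expo hc hΨ u).cexp.congr fun k => ?_) h2
  rw [hZ.ch_integral]

end Single

lemma Step.integral_path_sub {h : ℝ≥0} (φ : Step h) {Ω E : Type*} [NormedAddCommGroup E]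
    [NormedSpace ℝ E] (Z Z' : ℝ≥0 → Ω → E) (ω : Ω) :
    φ.integral (fun s ω => Z s ω - Z' s ω) ω = φ.integral Z ω - φ.integral Z' ω := by
  simp only [Step.integral, ← Finset.sum_sub_distrib, ← smul_sub]
  refine Finset.sum_congr rfl fun j _ => ?_
  congr 1
  abel

/-! ### Processes with an exponent: limits and the Lévy property. -/

section ExponentProcess

variable {Ω : Type*} [MeasurableSpace Ω] {P : Measure Ω}
  {E : Type*} [NormedAddCommGroup E] [InnerProductSpace ℝ E]
  [MeasurableSpace E] [BorelSpace E] [FiniteDimensional ℝ E]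

/-- Limits in probability of processes with exponents. -/
lemma HasExponent.of_tendsto [IsProbabilityMeasure P] {ι : Type*} {l : Filter ι} [l.NeBot]
    [l.IsCountablyGenerated] {W : ι → ℝ≥0 → Ω → E} {κ : ι → E → ℂ} {W₀ : ℝ≥0 → Ω → E} {κ₀ : E → ℂ}
    (hW : ∀ i, HasExponent (W i) P (κ i)) (hκ : ∀ u, Tendsto (fun i => κ i u) l (𝓝 (κ₀ u)))
    (hm : ∀ t, Measurable (W₀ t))
    (hlim : ∀ t, TendstoInMeasure P (fun i => W i t) l (W₀ t)) : HasExponent W₀ P κ₀ where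
  measurable := hm
  start := tendstoInMeasure_ae_unique ((hlim 0).congr_left fun i => (hW i).start)
    (tendstoInMeasure_const fun _ => (0 : E))
  ch_eq n t ht u := by
    have hsc : SecondCountableTopology E :=
      have := FiniteDimensional.proper_real E; inferInstance
    have h1 : Tendsto (fun i => ch P (fun ω => ∑ j ∈ Finset.range n,
        ⟪W i (t (j + 1)) ω - W i (t j) ω, u j⟫_ℝ)) l (𝓝 (ch P (fun ω => ∑ j ∈ Finset.range n,
        ⟪W₀ (t (j + 1)) ω - W₀ (t j) ω, u j⟫_ℝ))) := by
      refine tendsto_ch (fun i => ?_) ?_ ?_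
      · exact (measurable_sum_inner_sub (X := fun j => W i (t (j + 1))) (Y := fun j => W i (t j))
          _ u (fun j => (hW i).measurable _) (fun j => (hW i).measurable _)).aemeasurable
      · exact (measurable_sum_inner_sub (X := fun j => W₀ (t (j + 1))) (Y := fun j => W₀ (t j))
          _ u (fun j => hm _) (fun j => hm _)).aemeasurable
      · exact tendstoInMeasure_finsetSum
          (F := fun j i ω => ⟪W i (t (j + 1)) ω - W i (t j) ω, u j⟫_ℝ)
          (G := fun j ω => ⟪W₀ (t (j + 1)) ω - W₀ (t j) ω, u j⟫_ℝ) _ fun j _ =>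
          tendstoInMeasure_inner (F := fun i ω => W i (t (j + 1)) ω - W i (t j) ω)
            (G := fun ω => W₀ (t (j + 1)) ω - W₀ (t j) ω)
            (tendstoInMeasure_sub (hlim (t (j + 1))) (hlim (t j))) (u j)
    refine tendsto_nhds_unique h1 ?_
    simp only [fun i => (hW i).ch_eq n t ht u]
    exact (tendsto_finsetSum _ fun j _ => (hκ (u j)).const_mul _).cexp

/-- Factorization of the joint formula gives independence, its dependence on `t - s` alone gives
stationarity, and `exp((t - s) κ) → 1` gives continuity in probability. No regularity of `κ` is
involved. -/
theorem HasExponent.isLevyInLaw [IsProbabilityMeasure P] {W : ℝ≥0 → Ω → E} {κ : E → ℂ}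
    (hW : HasExponent W P κ) : IsLevyInLaw W P where
  measurable := hW.measurable
  start := hW.start
  indep := by
    have hsc : SecondCountableTopology E :=
      have := FiniteDimensional.proper_real E; inferInstance
    intro n t ht
    have hm : ∀ i : Fin n, Measurable fun ω => W (t i.succ) ω - W (t i.castSucc) ω := fun i =>
      (hW.measurable _).sub (hW.measurable _)
    rw [iIndepFun_iff_charFun_pi fun i => (hm i).aemeasurable]
    intro v
    have hmL : Measurable fun ω => WithLp.toLp 2 fun i : Fin n =>
        W (t i.succ) ω - W (t i.castSucc) ω :=
      (WithLp.measurable_toLp 2 _).comp (measurable_pi_lambda _ hm)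
    rw [charFun_map_eq_ch hmL.aemeasurable]
    have hprod : ∀ i : Fin n, charFun (P.map fun ω => W (t i.succ) ω - W (t i.castSucc) ω) (v i) =
        Complex.exp (((t i.succ : ℝ) - t i.castSucc : ℝ) * κ (v i)) := fun i => by
      rw [charFun_map_eq_ch (hm i).aemeasurable,
        hW.ch_sub (ht (Fin.castSucc_le_succ i))]
    rw [Finset.prod_congr rfl fun i _ => hprod i, ← Complex.exp_sum]
    have h1 := hW.ch_eq n (fun k => t ⟨min k n, by omega⟩)
      (fun i j hij => ht (Fin.mk_le_mk.2 (min_le_min_right _ hij)))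
      (fun k => if hk : k < n then v ⟨k, hk⟩ else 0)
    have hs : ∀ i : Fin n, (⟨min ((i : ℕ) + 1) n, by omega⟩ : Fin (n + 1)) = i.succ := fun i =>
      Fin.ext (by simp only [Fin.val_succ]; omega)
    have hcs : ∀ i : Fin n, (⟨min (i : ℕ) n, by omega⟩ : Fin (n + 1)) = i.castSucc := fun i =>
      Fin.ext (by simp only [Fin.val_castSucc]; omega)
    simp only [Finset.sum_range, hs, hcs, Fin.is_lt, dite_true, Fin.eta] at h1
    rw [← h1]
    congr 1
  stationary s t := by
    have hsc : SecondCountableTopology E :=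
      have := FiniteDimensional.proper_real E; inferInstance
    refine identDistrib_of_ch_eq ((hW.measurable _).sub (hW.measurable _))
      ((hW.measurable _).sub (hW.measurable _)) fun u => ?_
    rw [hW.ch_sub le_self_add, hW.ch_sub zero_le]
    simp
  stochContinuous t := by
    have hsc : SecondCountableTopology E :=
      have := FiniteDimensional.proper_real E; inferInstance
    refine tendstoInMeasure_of_sub (F' := fun _ => W t) ?_ (tendstoInMeasure_const _)
    refine tendstoInMeasure_zero_of_tendsto_ch
      (fun s => (hW.measurable s).sub (hW.measurable t)) fun u => ?_
    -- For `s < t` the increment is reversed and its sign moved onto `u`.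
    have heq : ∀ s, ch P (fun ω => ⟪W s ω - W t ω, u⟫_ℝ) =
        if t ≤ s then Complex.exp (((s : ℝ) - t : ℝ) * κ u)
        else Complex.exp (((t : ℝ) - s : ℝ) * κ (-u)) := by
      intro s
      split_ifs with hts
      · exact hW.ch_sub hts u
      · rw [← hW.ch_sub (not_le.1 hts).le (-u)]
        congr 1
        ext ω
        rw [inner_neg_right, ← inner_neg_left, neg_sub]
    simp only [heq]
    have hl : ∀ F : ℝ≥0 → ℂ, Continuous F → F t = 1 → Tendsto F (𝓝 t) (𝓝 1) := fun F hF h1 =>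
      h1 ▸ hF.tendsto t
    exact (hl _ (by fun_prop) (by simp)).if' (hl _ (by fun_prop) (by simp))

end ExponentProcess

/-! ### Step integrals against the sheet. -/

section Sheet

variable {Ω Ω' : Type*} [MeasurableSpace Ω] [MeasurableSpace Ω'] {P : Measure Ω} {P' : Measure Ω'}
  {E : Type*} [NormedAddCommGroup E] [InnerProductSpace ℝ E]
  [MeasurableSpace E] [BorelSpace E] [FiniteDimensional ℝ E]
  {L : ℝ≥0 → Ω → E} {M : ℝ≥0 → ℝ≥0 → Ω' → E} {ψ : E → ℂ} {h : ℝ≥0}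

/-- Integration runs along the first parameter because the sheet conditions describe increments in
the second: such an increment is a process with the law of `L` at speed `t₂ - t₁`, independent of
the past. -/
lemma IsLevySheetExtending.hasExponent_left [IsProbabilityMeasure P']
    (hM : IsLevySheetExtending M P' L P) (hL : HasExponent L P ψ) (φ : Step h) :
    HasExponent (fun t => φ.integral fun s => M s t) P' (φ.expo ψ) := by
  have hsc : SecondCountableTopology E :=
    have := FiniteDimensional.proper_real E; inferInstance
  have hm : ∀ t, Measurable (φ.integral fun s => M s t) := fun t =>
    φ.measurable_integral fun s => hM.measurable s t
  refine ⟨hm, ?_, fun n t ht u => ?_⟩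
  · have : ∀ᵐ ω ∂P', ∀ j, M (φ.t j) 0 ω = 0 := ae_all_iff.2 fun j => hM.zero_right _
    filter_upwards [this] with ω hω
    simp [Step.integral, hω]
  · have hincr : ∀ t₁ t₂, t₁ ≤ t₂ → ∀ v,
        ch P' (fun ω => ⟪φ.integral (fun s => M s t₂) ω - φ.integral (fun s => M s t₁) ω, v⟫_ℝ) =
          Complex.exp (((t₂ : ℝ) - t₁ : ℝ) * φ.expo ψ v) := by
      intro t₁ t₂ h12 v
      have h1 := (hM.increment_law t₁ t₂ h12).comp
        (measurable_inner_const φ.measurable_integral_path v)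
      have h2 := ch_identDistrib h1
      simp only [Function.comp_def] at h2
      have h3 := (hL.comp_mul (t₂ - t₁)).stepExponent.ch_integral φ v
      rw [φ.expo_const_mul] at h3
      rw [← NNReal.coe_sub h12]
      simp only [← Step.integral_path_sub]
      exact h2.trans h3
    induction n with
    | zero => simp [ch_zero]
    | succ n ih =>
      simp only [Finset.sum_range_succ]
      have hS : Measurable fun ω => ∑ j ∈ Finset.range n,
          ⟪φ.integral (fun s => M s (t (j + 1))) ω - φ.integral (fun s => M s (t j)) ω, u j⟫_ℝ :=
        measurable_sum_inner_sub (X := fun j => φ.integral fun s => M s (t (j + 1)))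
          (Y := fun j => φ.integral fun s => M s (t j)) _ u (fun j => hm _) (fun j => hm _)
      have hR : Measurable fun ω => ⟪φ.integral (fun s => M s (t (n + 1))) ω -
          φ.integral (fun s => M s (t n)) ω, u n⟫_ℝ :=
        measurable_inner_sub (hm _) (hm _) _
      have hind : IndepFun (fun ω => ∑ j ∈ Finset.range n,
          ⟪φ.integral (fun s => M s (t (j + 1))) ω - φ.integral (fun s => M s (t j)) ω, u j⟫_ℝ)
          (fun ω => ⟪φ.integral (fun s => M s (t (n + 1))) ω -
            φ.integral (fun s => M s (t n)) ω, u n⟫_ℝ) P' := by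
        -- The minimum with `t n` only makes every index admissible; it changes nothing for `j ≤ n`.
        let H : (ℝ≥0 × Set.Iic (t n) → E) → ℝ := fun g => ∑ j ∈ Finset.range n,
          ⟪φ.integral (fun s (g : ℝ≥0 × Set.Iic (t n) → E) =>
              g (s, ⟨min (t (j + 1)) (t n), Set.mem_Iic.2 (min_le_right _ _)⟩)) g -
            φ.integral (fun s (g : ℝ≥0 × Set.Iic (t n) → E) =>
              g (s, ⟨min (t j) (t n), Set.mem_Iic.2 (min_le_right _ _)⟩)) g, u j⟫_ℝ
        have hH : Measurable H := measurable_sum_inner_sub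
          (X := fun j => φ.integral fun s (g : ℝ≥0 × Set.Iic (t n) → E) =>
            g (s, ⟨min (t (j + 1)) (t n), Set.mem_Iic.2 (min_le_right _ _)⟩))
          (Y := fun j => φ.integral fun s (g : ℝ≥0 × Set.Iic (t n) → E) =>
            g (s, ⟨min (t j) (t n), Set.mem_Iic.2 (min_le_right _ _)⟩)) _ u
          (fun j => φ.measurable_integral fun s => measurable_pi_apply _)
          (fun j => φ.measurable_integral fun s => measurable_pi_apply _)
        have h1 := ((hM.increment_indep (t n) (t (n + 1)) (ht (Nat.le_succ n))).comp
          (measurable_inner_const φ.measurable_integral_path (u n)) hH).symm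
        convert h1 using 1
        · ext ω
          refine Finset.sum_congr rfl fun j hj => ?_
          have hj' := Finset.mem_range.1 hj
          simp only [min_eq_left (ht (show j + 1 ≤ n by omega)),
            min_eq_left (ht (show j ≤ n by omega))]
          rfl
        · ext ω
          rw [← Step.integral_path_sub]
          rfl
      rw [ch_add_of_indepFun hS.aemeasurable hR.aemeasurable hind, ih, Complex.exp_add,
        hincr _ _ (ht (Nat.le_succ n))]

/-- The elementary integrals `∫ φ(s) d_s M_{t,s}` form a process with exponent in `t`. -/
lemma IsLevySheetExtending.hasExponent [IsProbabilityMeasure P']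
    (hM : IsLevySheetExtending M P' L P) (hL : HasExponent L P ψ) (φ : Step h) :
    HasExponent (fun t => φ.integral (M t)) P' (φ.expo ψ) := by
  have hsc : SecondCountableTopology E :=
    have := FiniteDimensional.proper_real E; inferInstance
  refine ⟨fun t => φ.measurable_integral (hM.measurable t), ?_, fun n t ht u => ?_⟩
  · have : ∀ᵐ ω ∂P', ∀ j, M 0 (φ.t j) ω = 0 := ae_all_iff.2 fun j => hM.zero_left _
    filter_upwards [this] with ω hω
    simp [Step.integral, hω]
  · rw [← (hM.hasExponent_left hL φ).ch_eq n t ht u]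
    -- The joint increments as a functional of the whole sheet, so that symmetry in law exchanges
    -- the two parameters.
    let H : (ℝ≥0 × ℝ≥0 → E) → ℝ := fun g => ∑ j ∈ Finset.range n,
      ⟪φ.integral (fun s (g : ℝ≥0 × ℝ≥0 → E) => g (t (j + 1), s)) g -
        φ.integral (fun s (g : ℝ≥0 × ℝ≥0 → E) => g (t j, s)) g, u j⟫_ℝ
    have hH : Measurable H := measurable_sum_inner_sub
      (X := fun j => φ.integral fun s (g : ℝ≥0 × ℝ≥0 → E) => g (t (j + 1), s))
      (Y := fun j => φ.integral fun s (g : ℝ≥0 × ℝ≥0 → E) => g (t j, s)) _ u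
      (fun j => φ.measurable_integral fun s => measurable_pi_apply _)
      (fun j => φ.measurable_integral fun s => measurable_pi_apply _)
    exact ch_identDistrib (hM.symm_law.comp hH)

lemma IsLevySheetExtending.stepExponent [IsProbabilityMeasure P']
    (hM : IsLevySheetExtending M P' L P) (hL : HasExponent L P ψ) (t : ℝ≥0) :
    StepExponent (M t) P' (fun u => (t : ℂ) * ψ u) where
  measurable := hM.measurable t
  ch_integral φ u := by
    rw [(hM.hasExponent hL φ).ch_eval t u, φ.expo_const_mul]

end Sheet

/-! ### Maximal inequality for sums of independent variables. -/

section Ottaviani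

variable {Ω : Type*} [MeasurableSpace Ω] {P : Measure Ω} [IsProbabilityMeasure P]
  {E : Type*} [NormedAddCommGroup E] [MeasurableSpace E] [BorelSpace E] [SecondCountableTopology E]

/-- Ottaviani's maximal inequality. -/
lemma measure_exists_lt_norm_sum_le {X : ℕ → Ω → E} (hm : ∀ i, Measurable (X i))
    (hX : iIndepFun X P) {N : ℕ} {ε : ℝ}
    (hsmall : ∀ k ≤ N, P {ω | ε < ‖∑ i ∈ Finset.Ico k N, X i ω‖} ≤ 1 / 2) :
    P {ω | ∃ k ≤ N, 2 * ε < ‖∑ i ∈ Finset.range k, X i ω‖} ≤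
      2 * P {ω | ε < ‖∑ i ∈ Finset.range N, X i ω‖} := by
  -- `A k`: the partial sums exceed `2 * ε` for the first time at `k`. `B k`: the remaining sum
  -- exceeds `ε`. They depend on disjoint blocks of variables.
  set A : ℕ → Set Ω := fun k => {ω | (∀ j < k, ‖∑ i ∈ Finset.range j, X i ω‖ ≤ 2 * ε) ∧
    2 * ε < ‖∑ i ∈ Finset.range k, X i ω‖} with hA
  set B : ℕ → Set Ω := fun k => {ω | ε < ‖∑ i ∈ Finset.Ico k N, X i ω‖} with hB
  set C : Set Ω := {ω | ε < ‖∑ i ∈ Finset.range N, X i ω‖} with hC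
  have hsum : ∀ s : Finset ℕ, Measurable fun ω => ∑ i ∈ s, X i ω := fun s =>
    Finset.measurable_fun_sum _ fun i _ => hm i
  have hBm : ∀ k, MeasurableSet (B k) := fun k => measurableSet_lt measurable_const (hsum _).norm
  have hCm : MeasurableSet C := measurableSet_lt measurable_const (hsum _).norm
  have hAm : ∀ k, MeasurableSet (A k) := fun k => by
    have : A k = (⋂ j, ⋂ (_ : j < k), {ω | ‖∑ i ∈ Finset.range j, X i ω‖ ≤ 2 * ε}) ∩
        {ω | 2 * ε < ‖∑ i ∈ Finset.range k, X i ω‖} := by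
      ext ω
      simp [hA]
    rw [this]
    exact (MeasurableSet.iInter fun j => MeasurableSet.iInter fun _ =>
      measurableSet_le (hsum _).norm measurable_const).inter
      (measurableSet_lt measurable_const (hsum _).norm)
  have hind : ∀ k ≤ N, P (A k ∩ (B k)ᶜ) = P (A k) * P (B k)ᶜ := by
    intro k hk
    have hI := hX.indepFun_finset (Finset.range k) (Finset.Ico k N)
      (Finset.disjoint_left.2 fun i h1 h2 => by
        rw [Finset.mem_range] at h1
        rw [Finset.mem_Ico] at h2
        omega) hm
    set S : ℕ → (Finset.range k → E) → E := fun j g =>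
      ∑ i : Finset.range k, if (i : ℕ) < j then g i else 0 with hS
    have hSm : ∀ j, Measurable (S j) := fun j => Finset.measurable_fun_sum _ fun i _ => by
      by_cases hij : (i : ℕ) < j
      · simpa [hij] using measurable_pi_apply i
      · simp [hij]
    have hSeq : ∀ j ≤ k, ∀ ω, S j (fun i => X i ω) = ∑ i ∈ Finset.range j, X i ω := by
      intro j hj ω
      simp only [hS]
      rw [Finset.sum_coe_sort (Finset.range k) fun i => if i < j then X i ω else 0,
        ← Finset.sum_filter]
      congr 1
      ext i
      simp only [Finset.mem_filter, Finset.mem_range]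
      omega
    have h1 : MeasurableSet {g | (∀ j < k, ‖S j g‖ ≤ 2 * ε) ∧ 2 * ε < ‖S k g‖} := by
      have : {g | (∀ j < k, ‖S j g‖ ≤ 2 * ε) ∧ 2 * ε < ‖S k g‖} =
          (⋂ j, ⋂ (_ : j < k), {g | ‖S j g‖ ≤ 2 * ε}) ∩ {g | 2 * ε < ‖S k g‖} := by
        ext g
        simp
      rw [this]
      exact (MeasurableSet.iInter fun j => MeasurableSet.iInter fun _ =>
        measurableSet_le (hSm _).norm measurable_const).inter
        (measurableSet_lt measurable_const (hSm _).norm)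
    have h2 : MeasurableSet {g : Finset.Ico k N → E | ε < ‖∑ i, g i‖}ᶜ :=
      (measurableSet_lt measurable_const (Finset.measurable_fun_sum _ fun i _ =>
        measurable_pi_apply i).norm).compl
    have h3 := hI.measure_inter_preimage_eq_mul _ _ h1 h2
    convert h3 using 3
    · ext ω
      simp only [hA, Set.mem_ofPred_eq, Set.mem_preimage, hSeq k le_rfl]
      exact and_congr_left fun _ => forall₂_congr fun j hj => by rw [hSeq j hj.le]
    · ext ω
      simp only [hB, Set.mem_compl_iff, Set.mem_ofPred_eq, Set.mem_preimage]
      rw [Finset.sum_coe_sort (Finset.Ico k N) fun i => X i ω]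
    · ext ω
      simp only [hA, Set.mem_ofPred_eq, Set.mem_preimage, hSeq k le_rfl]
      exact and_congr_left fun _ => forall₂_congr fun j hj => by rw [hSeq j hj.le]
    · ext ω
      simp only [hB, Set.mem_compl_iff, Set.mem_ofPred_eq, Set.mem_preimage]
      rw [Finset.sum_coe_sort (Finset.Ico k N) fun i => X i ω]
  -- Off `B k`, an event of probability at least `1/2` independent of `A k`, the total stays above
  -- `2ε - ε = ε`.
  have hstep : ∀ k ≤ N, P (A k) ≤ 2 * P (A k ∩ C) := by
    intro k hk
    have h1 : 1 ≤ 2 * P (B k)ᶜ := by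
      rw [prob_compl_eq_one_sub (hBm k)]
      have h2 : (1 : ℝ≥0∞) - 1 / 2 ≤ 1 - P (B k) := tsub_le_tsub_left (hsmall k hk) 1
      have h3 : (1 : ℝ≥0∞) = 2 * (1 - 1 / 2) := by
        rw [one_div, ENNReal.one_sub_inv_two, ENNReal.mul_inv_cancel] <;> simp
      calc (1 : ℝ≥0∞) = 2 * (1 - 1 / 2) := h3
        _ ≤ _ := by gcongr
    calc P (A k) = P (A k) * 1 := (mul_one _).symm
      _ ≤ P (A k) * (2 * P (B k)ᶜ) := by gcongr
      _ = 2 * P (A k ∩ (B k)ᶜ) := by rw [hind k hk]; ring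
      _ ≤ 2 * P (A k ∩ C) := by
        gcongr 2 * P ?_
        rintro ω ⟨h4, h5⟩
        refine ⟨h4, ?_⟩
        simp only [hA, hB, hC, Set.mem_compl_iff, Set.mem_ofPred_eq, not_lt] at h4 h5 ⊢
        rw [← Finset.sum_range_add_sum_Ico _ hk]
        have := norm_sub_le_norm_add (∑ i ∈ Finset.range k, X i ω) (∑ i ∈ Finset.Ico k N, X i ω)
        linarith
  calc P {ω | ∃ k ≤ N, 2 * ε < ‖∑ i ∈ Finset.range k, X i ω‖}
      ≤ P (⋃ k ∈ Finset.range (N + 1), A k) := by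
        refine measure_mono fun ω hω => ?_
        classical
        have hω' : ∃ k, k ≤ N ∧ 2 * ε < ‖∑ i ∈ Finset.range k, X i ω‖ := hω
        have hspec := Nat.find_spec hω'
        refine Set.mem_biUnion (x := Nat.find hω') (Finset.mem_range.2 (by omega)) ⟨?_, hspec.2⟩
        intro j hj
        have := Nat.find_min hω' hj
        push Not at this
        exact this (by omega)
    _ ≤ ∑ k ∈ Finset.range (N + 1), P (A k) := measure_biUnion_finset_le _ _
    _ ≤ ∑ k ∈ Finset.range (N + 1), 2 * P (A k ∩ C) :=
        Finset.sum_le_sum fun k hk => hstep k (by rw [Finset.mem_range] at hk; omega)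
    _ = 2 * P (⋃ k ∈ Finset.range (N + 1), A k ∩ C) := by
        rw [← Finset.mul_sum, measure_biUnion_finset _ fun k _ => (hAm k).inter hCm]
        intro j _ k _ hjk
        refine Set.disjoint_left.2 fun ω h1 h2 => ?_
        rcases lt_or_gt_of_ne hjk with h | h
        · exact absurd h1.1.2 (not_lt.2 (h2.1.1 j h))
        · exact absurd h2.1.2 (not_lt.2 (h1.1.1 k h))
    _ ≤ 2 * P C := by
        gcongr 2 * P ?_
        exact Set.iUnion₂_subset fun k _ => Set.inter_subset_right

end Ottaviani

/-! ### Càdlàg paths and uniform limits. -/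

section Cadlag

variable {E : Type*} [NormedAddCommGroup E]

lemma IsCadlag.sub {g g' : ℝ≥0 → E} (hg : IsCadlag g) (hg' : IsCadlag g') :
    IsCadlag fun t => g t - g' t := fun t =>
  ⟨(hg t).1.sub (hg' t).1, let ⟨l, hl⟩ := (hg t).2; let ⟨l', hl'⟩ := (hg' t).2
    ⟨l - l', hl.sub hl'⟩⟩

lemma isCadlag_const (x : E) : IsCadlag fun _ => x := fun _ =>
  ⟨continuousWithinAt_const, x, tendsto_const_nhds⟩

lemma Step.isCadlag_integral [NormedSpace ℝ E] {h : ℝ≥0} (φ : Step h) {Ω : Type*}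
    {M : ℝ≥0 → ℝ≥0 → Ω → E} {ω : Ω} (hM : ∀ s, IsCadlag fun t => M t s ω) :
    IsCadlag fun t => φ.integral (M t) ω := by
  intro t
  refine ⟨?_, ?_⟩
  · exact tendsto_finsetSum _ fun j _ =>
      (((hM (φ.t (j + 1)) t).1.tendsto).sub ((hM (φ.t j) t).1.tendsto)).const_smul _
  · choose l hl using fun s => (hM s t).2
    exact ⟨_, tendsto_finsetSum _ fun j _ => ((hl (φ.t (j + 1))).sub (hl (φ.t j))).const_smul _⟩

lemma exists_tendsto_of_uniform_approx [CompleteSpace E] {p : Filter ℝ≥0} [p.NeBot] {F : ℝ≥0 → E}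
    (h : ∀ ε : ℝ, 0 < ε → ∃ g : ℝ≥0 → E, (∃ l, Tendsto g p (𝓝 l)) ∧
      ∀ᶠ x in p, ‖F x - g x‖ ≤ ε) : ∃ l, Tendsto F p (𝓝 l) := by
  have hC : Cauchy (map F p) := by
    refine Metric.cauchy_iff.2 ⟨inferInstance, fun ε hε => ?_⟩
    obtain ⟨g, ⟨l, hl⟩, hg⟩ := h (ε / 5) (by positivity)
    have h1 := Metric.tendsto_nhds.1 hl (ε / 5) (by positivity)
    refine ⟨F '' {x | ‖F x - g x‖ ≤ ε / 5 ∧ dist (g x) l < ε / 5},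
      image_mem_map (hg.and h1), ?_⟩
    rintro _ ⟨x, hx, rfl⟩ _ ⟨y, hy, rfl⟩
    have h2 : dist (F x) (g x) ≤ ε / 5 := by rw [dist_eq_norm]; exact hx.1
    have h3 : dist (F y) (g y) ≤ ε / 5 := by rw [dist_eq_norm]; exact hy.1
    have h4 := dist_triangle4 (F x) (g x) (g y) (F y)
    have h5 := dist_triangle_right (g x) (g y) l
    rw [dist_comm (g y) (F y)] at h4
    linarith [hx.2, hy.2]
  exact CompleteSpace.complete hC

lemma isCadlag_of_uniform_approx [CompleteSpace E] {F : ℝ≥0 → E}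
    (h : ∀ (T : ℝ≥0) (ε : ℝ), 0 < ε → ∃ g, IsCadlag g ∧ ∀ t ≤ T, ‖F t - g t‖ ≤ ε) :
    IsCadlag F := by
  intro t
  have hle : ∀ᶠ x in 𝓝 t, x ≤ t + 1 := by
    filter_upwards [Iio_mem_nhds (show t < t + 1 from lt_add_of_pos_right t one_pos)] with x hx
    exact le_of_lt hx
  refine ⟨?_, ?_⟩
  · obtain ⟨l, hl⟩ := exists_tendsto_of_uniform_approx (p := 𝓝[≥] t) (F := F) fun ε hε => by
      obtain ⟨g, hg, hFg⟩ := h (t + 1) ε hε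
      exact ⟨g, ⟨_, (hg t).1⟩, (hle.filter_mono nhdsWithin_le_nhds).mono hFg⟩
    -- The right neighbourhoods include `t` itself, so the limit along them can only be `F t`.
    have hpure : Tendsto F (pure t) (𝓝 l) := hl.mono_left (pure_le_nhdsWithin (Set.mem_Ici.2 le_rfl))
    have : F t = l := tendsto_nhds_unique (tendsto_pure_nhds F t) hpure
    rw [ContinuousWithinAt, this]
    exact hl
  -- At `t = 0` the left filter is trivial and any value is a limit.
  · rcases eq_or_neBot (𝓝[<] t) with hb | hb
    · exact ⟨0, by rw [hb]; exact tendsto_bot⟩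
    · exact exists_tendsto_of_uniform_approx fun ε hε => by
        obtain ⟨g, hg, hFg⟩ := h (t + 1) ε hε
        exact ⟨g, (hg t).2, (hle.filter_mono nhdsWithin_le_nhds).mono hFg⟩

end Cadlag

/-! ### Maximal inequality in continuous time. -/

section Maximal

variable {Ω : Type*} [MeasurableSpace Ω] {P : Measure Ω} [IsProbabilityMeasure P]
  {E : Type*} [NormedAddCommGroup E] [InnerProductSpace ℝ E]
  [MeasurableSpace E] [BorelSpace E] [FiniteDimensional ℝ E]

/-- Ottaviani's inequality for the increments along a grid containing `F` and `T`. By stationarity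
the remainder `W_T - W_{τ k}` has the law of `W_{T - τ k}`, so smallness of the marginals suffices.
-/
lemma HasExponent.measure_exists_finset_le {W : ℝ≥0 → Ω → E} {κ : E → ℂ}
    (hW : HasExponent W P κ) {T : ℝ≥0} {ε : ℝ} (hsmall : ∀ t ≤ T, P {ω | ε < ‖W t ω‖} ≤ 1 / 2)
    (F : Finset ℝ≥0) (hF : ∀ t ∈ F, t ≤ T) :
    P {ω | ∃ t ∈ F, 2 * ε < ‖W t ω‖} ≤ 2 * P {ω | ε < ‖W T ω‖} := by
  have hsc : SecondCountableTopology E :=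
    have := FiniteDimensional.proper_real E; inferInstance
  classical
  obtain ⟨N, τ, m, hτ, hτ0, hτF, hm⟩ := exists_grid (insert T F)
  have hτT : ∀ i, τ i ≤ T := by
    intro i
    have := hτF i
    simp only [Finset.mem_insert] at this
    rcases this with h | h | h
    · rw [h]; exact zero_le
    · exact h.le
    · exact hF _ h
  have hτN : τ N = T := by
    refine le_antisymm (hτT N) ?_
    obtain ⟨h1, h2⟩ := hm T (Finset.mem_insert_self T F)
    rw [← h2]
    exact hτ h1
  have hlaw := hW.isLevyInLaw
  set X : ℕ → Ω → E := fun i ω => W (τ (i + 1)) ω - W (τ i) ω with hX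
  have hXm : ∀ i, Measurable (X i) := fun i => (hW.measurable _).sub (hW.measurable _)
  have hsumIco : ∀ k ≤ N, ∀ ω, ∑ i ∈ Finset.Ico k N, X i ω = W T ω - W (τ k) ω := by
    intro k hk ω
    rw [← hτN]
    exact Finset.sum_Ico_sub (fun i => W (τ i) ω) hk
  have hsumr : ∀ k ω, ∑ i ∈ Finset.range k, X i ω = W (τ k) ω - W 0 ω := by
    intro k ω
    rw [← hτ0]
    exact Finset.sum_range_sub (fun i => W (τ i) ω) k
  have hmain := measure_exists_lt_norm_sum_le (P := P) (N := N) (ε := ε) hXm (hlaw.indep.nat hτ)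
    (fun k hk => by
      have h1 := hlaw.stationary (τ k) (T - τ k)
      rw [add_tsub_cancel_of_le (hτT k)] at h1
      have h2 := h1.measure_mem_eq (s := {x | ε < ‖x‖})
        (measurableSet_lt measurable_const measurable_norm)
      have h3 : P {ω | ε < ‖∑ i ∈ Finset.Ico k N, X i ω‖} = P {ω | ε < ‖W (T - τ k) ω‖} := by
        simp only [hsumIco k hk]
        refine h2.trans (measure_congr ?_)
        filter_upwards [hW.start] with ω hω
        change (ε < ‖W (T - τ k) ω - W 0 ω‖) = (ε < ‖W (T - τ k) ω‖)
        rw [hω, sub_zero]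
      rw [h3]
      exact hsmall _ tsub_le_self)
  have hleft : P {ω | ∃ t ∈ F, 2 * ε < ‖W t ω‖} ≤
      P {ω | ∃ k ≤ N, 2 * ε < ‖∑ i ∈ Finset.range k, X i ω‖} := by
    refine measure_mono_ae ?_
    filter_upwards [hW.start] with ω hω
    rintro ⟨t, ht, hlt⟩
    obtain ⟨h1, h2⟩ := hm t (Finset.mem_insert_of_mem ht)
    refine ⟨m t, h1, ?_⟩
    rwa [hsumr, h2, hω, sub_zero]
  have hright : P {ω | ε < ‖∑ i ∈ Finset.range N, X i ω‖} = P {ω | ε < ‖W T ω‖} := by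
    refine measure_congr ?_
    filter_upwards [hW.start] with ω hω
    change (ε < ‖∑ i ∈ Finset.range N, X i ω‖) = (ε < ‖W T ω‖)
    rw [hsumr, hω, sub_zero, hτN]
  calc _ ≤ _ := hleft
    _ ≤ _ := hmain
    _ = _ := by rw [hright]

/-- Ottaviani's maximal inequality for a process with càdlàg paths. -/
theorem HasExponent.measure_exists_le {W : ℝ≥0 → Ω → E} {κ : E → ℂ}
    (hW : HasExponent W P κ) (hcad : ∀ᵐ ω ∂P, IsCadlag fun t => W t ω) {T : ℝ≥0} {ε : ℝ}
    (hsmall : ∀ t ≤ T, P {ω | ε < ‖W t ω‖} ≤ 1 / 2) :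
    P {ω | ∃ t ≤ T, 2 * ε < ‖W t ω‖} ≤ 2 * P {ω | ε < ‖W T ω‖} := by
  classical
  obtain ⟨D, hDc, hD⟩ := TopologicalSpace.exists_countable_dense ℝ≥0
  -- Right-continuity moves an exceedance at `t < T` to a point of `D` just to its right; `T` has no
  -- such neighbour in `[0, T]` and is added by hand.
  obtain ⟨d, hd⟩ := (((hDc.mono (Set.inter_subset_left (t := Set.Iic T))).insert T)).exists_eq_range
    (Set.insert_nonempty _ _)
  have hdT : ∀ i, d i ≤ T := by
    intro i
    have : d i ∈ insert T (D ∩ Set.Iic T) := hd ▸ Set.mem_range_self i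
    rcases this with h | h
    · exact h.le
    · exact h.2
  have hcount : P {ω | ∃ i, 2 * ε < ‖W (d i) ω‖} ≤ 2 * P {ω | ε < ‖W T ω‖} := by
    have hU : {ω | ∃ i, 2 * ε < ‖W (d i) ω‖} =
        ⋃ n : ℕ, {ω | ∃ t ∈ (Finset.range n).image d, 2 * ε < ‖W t ω‖} := by
      ext ω
      simp only [Set.mem_ofPred_eq, Set.mem_iUnion, Finset.mem_image, Finset.mem_range]
      constructor
      · rintro ⟨i, hi⟩
        exact ⟨i + 1, d i, ⟨i, by omega, rfl⟩, hi⟩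
      · rintro ⟨n, _, ⟨i, _, rfl⟩, hi⟩
        exact ⟨i, hi⟩
    rw [hU, Monotone.measure_iUnion]
    · refine iSup_le fun n => hW.measure_exists_finset_le hsmall _ fun t ht => ?_
      obtain ⟨i, _, rfl⟩ := Finset.mem_image.1 ht
      exact hdT i
    · rintro n n' hn ω ⟨t, ht, hlt⟩
      exact ⟨t, Finset.image_subset_image (Finset.range_mono hn) ht, hlt⟩
  refine (measure_mono_ae ?_).trans hcount
  filter_upwards [hcad] with ω hω
  rintro ⟨t, htT, hlt⟩
  suffices ∃ s ∈ insert T (D ∩ Set.Iic T), 2 * ε < ‖W s ω‖ by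
    obtain ⟨s, hs, hlts⟩ := this
    rw [hd] at hs
    obtain ⟨i, rfl⟩ := hs
    exact ⟨i, hlts⟩
  rcases htT.eq_or_lt with rfl | htT
  · exact ⟨t, Set.mem_insert _ _, hlt⟩
  · have hev : {s | 2 * ε < ‖W s ω‖} ∈ 𝓝[≥] t :=
      (hω t).1.norm.eventually_const_lt hlt
    obtain ⟨u, hu, hsub⟩ := (mem_nhdsGE_iff_exists_Ico_subset' htT).1 hev
    obtain ⟨s, hsD, hs⟩ := hD.exists_between (lt_min hu htT)
    exact ⟨s, Set.mem_insert_of_mem _ ⟨hsD, (hs.2.trans_le (min_le_right _ _)).le⟩,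
      hsub ⟨hs.1.le, hs.2.trans_le (min_le_left _ _)⟩⟩

/-- If the exponents of càdlàg processes tend to zero, the processes tend to zero locally uniformly
in probability. -/
theorem eventually_measure_exists_le {ι : Type*} {l : Filter ι} [l.IsCountablyGenerated]
    {W : ι → ℝ≥0 → Ω → E} {κ : ι → E → ℂ} (hW : ∀ i, HasExponent (W i) P (κ i))
    (hcad : ∀ i, ∀ᵐ ω ∂P, IsCadlag fun t => W i t ω) (hκ : ∀ u, Tendsto (fun i => κ i u) l (𝓝 0))
    (T : ℝ≥0) {ε : ℝ} (hε : 0 < ε) {δ : ℝ≥0∞} (hδ : 0 < δ) :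
    ∀ᶠ i in l, P {ω | ∃ t ≤ T, ε < ‖W i t ω‖} ≤ δ := by
  -- The principal filter encodes uniformity over `t ≤ T`, available because `|t κ| ≤ T |κ|`.
  have hlim : TendstoInMeasure P (fun p : ι × ℝ≥0 => W p.1 p.2) (l ×ˢ 𝓟 (Set.Iic T))
      (fun _ => 0) := by
    refine tendstoInMeasure_zero_of_tendsto_ch (fun p => (hW p.1).measurable p.2) fun u => ?_
    simp only [fun p : ι × ℝ≥0 => (hW p.1).ch_eval p.2 u]
    have h1 : Tendsto (fun p : ι × ℝ≥0 => ((p.2 : ℝ) : ℂ) * κ p.1 u) (l ×ˢ 𝓟 (Set.Iic T))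
        (𝓝 0) := by
      have h2 : Tendsto (fun p : ι × ℝ≥0 => (T : ℝ) * ‖κ p.1 u‖) (l ×ˢ 𝓟 (Set.Iic T)) (𝓝 0) := by
        have := ((hκ u).norm.const_mul (T : ℝ)).comp (tendsto_fst (f := l) (g := 𝓟 (Set.Iic T)))
        simpa [Function.comp_def] using this
      refine squeeze_zero_norm' ?_ h2
      rw [eventually_prod_principal_iff]
      refine Eventually.of_forall fun i t ht => ?_
      rw [norm_mul, Complex.norm_real, Real.norm_of_nonneg t.coe_nonneg]
      exact mul_le_mul_of_nonneg_right (NNReal.coe_le_coe.2 ht) (norm_nonneg _)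
    simpa using h1.cexp
  rw [tendstoInMeasure_iff_norm] at hlim
  -- The bound `1/2` is the hypothesis of the maximal inequality; `δ/2` absorbs its factor `2`.
  have h3 := ENNReal.tendsto_nhds_zero.1 (hlim (ε / 2) (by positivity)) (min (1 / 2) (δ / 2))
    (lt_min (by simp) (ENNReal.div_pos hδ.ne' (by simp)))
  rw [eventually_prod_principal_iff] at h3
  filter_upwards [h3] with i hi
  have hlt : ∀ t ≤ T, P {ω | ε / 2 < ‖W i t ω‖} ≤ min (1 / 2) (δ / 2) := fun t ht =>
    (measure_mono fun ω hω => by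
      simp only [Set.mem_ofPred_eq, sub_zero] at hω ⊢
      exact hω.le).trans (hi t ht)
  have h4 := (hW i).measure_exists_le (hcad i) (T := T) (ε := ε / 2)
    fun t ht => (hlt t ht).trans (min_le_left _ _)
  rw [mul_div_cancel₀ ε (two_ne_zero)] at h4
  calc _ ≤ _ := h4
    _ ≤ 2 * (δ / 2) := by gcongr; exact (hlt T le_rfl).trans (min_le_right _ _)
    _ = δ := ENNReal.mul_div_cancel two_ne_zero (by simp)

end Maximal

/-! ### Completeness for locally uniform convergence in probability. -/

section Limit

variable {Ω : Type*} [MeasurableSpace Ω] {P : Measure Ω} [IsFiniteMeasure P]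
  {E : Type*} [NormedAddCommGroup E] [CompleteSpace E]
  [MeasurableSpace E] [BorelSpace E] [SecondCountableTopology E]
  {ι : Type*} [SemilatticeSup ι]

/-- A family of càdlàg processes which is Cauchy locally uniformly in probability has a càdlàg
limit. -/
theorem exists_cadlag_limit_of_cauchy {W : ι → ℝ≥0 → Ω → E} (hm : ∀ i t, Measurable (W i t))
    (hcad : ∀ i, ∀ᵐ ω ∂P, IsCadlag fun t => W i t ω)
    (hC : ∀ (T : ℝ≥0) (ε : ℝ), 0 < ε → ∃ N, ∀ i j, N ≤ i → i ≤ j →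
      P {ω | ∃ t ≤ T, ε < ‖W j t ω - W i t ω‖} ≤ ENNReal.ofReal ε) :
    ∃ W₀ : ℝ≥0 → Ω → E, (∀ t, Measurable (W₀ t)) ∧ (∀ᵐ ω ∂P, IsCadlag fun t => W₀ t ω) ∧
      ∀ t, TendstoInMeasure P (fun i => W i t) atTop (W₀ t) := by
  classical
  choose N hN using fun n : ℕ => hC n ((1 / 2) ^ n) (by positivity)
  -- Increasing indices past each threshold: consecutive terms differ by more than `2⁻ⁿ` somewhere
  -- on `[0, n]` with probability at most `2⁻ⁿ`, which is summable, so Borel–Cantelli applies.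
  let e : ℕ → ι := fun n => Nat.rec (N 0) (fun k x => x ⊔ N (k + 1)) n
  have he_mono : ∀ n, e n ≤ e (n + 1) := fun n => le_sup_left
  have heN : ∀ n, N n ≤ e n := by
    intro n
    cases n with
    | zero => exact le_rfl
    | succ k => exact le_sup_right
  set V : ℕ → ℝ≥0 → Ω → E := fun n => W (e n) with hV
  have hBC : ∀ᵐ ω ∂P, ∀ᶠ n : ℕ in atTop,
      ω ∉ {ω | ∃ t ≤ (n : ℝ≥0), (1 / 2 : ℝ) ^ n < ‖V (n + 1) t ω - V n t ω‖} := by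
    refine ae_eventually_notMem (ne_top_of_le_ne_top ?_
      (ENNReal.tsum_le_tsum fun n => hN n (e n) (e (n + 1)) (heN n) (he_mono n)))
    rw [← ENNReal.ofReal_tsum_of_nonneg (fun n => by positivity) summable_geometric_two]
    exact ENNReal.ofReal_ne_top
  have hgood : ∀ᵐ ω ∂P, (∀ᶠ n : ℕ in atTop,
      ω ∉ {ω | ∃ t ≤ (n : ℝ≥0), (1 / 2 : ℝ) ^ n < ‖V (n + 1) t ω - V n t ω‖}) ∧
      ∀ n, IsCadlag fun t => V n t ω :=
    hBC.and (ae_all_iff.2 fun n => hcad (e n))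
  -- The good event is shrunk to a measurable one, so that the limit set to `0` outside it is
  -- measurable.
  obtain ⟨G, hG, hGm, hGae⟩ : ∃ G : Set Ω, (∀ ω ∈ G, (∀ᶠ n : ℕ in atTop,
      ω ∉ {ω | ∃ t ≤ (n : ℝ≥0), (1 / 2 : ℝ) ^ n < ‖V (n + 1) t ω - V n t ω‖}) ∧
      ∀ n, IsCadlag fun t => V n t ω) ∧ MeasurableSet G ∧ ∀ᵐ ω ∂P, ω ∈ G := by
    obtain ⟨B, hB, hBm, hB0⟩ := exists_measurable_superset_of_null (ae_iff.1 hgood)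
    exact ⟨Bᶜ, fun ω hω => not_not.1 fun hc => hω (hB hc), hBm.compl, compl_mem_ae_iff.2 hB0⟩
  have hdist : ∀ ω ∈ G, ∃ n₀ : ℕ, ∀ n ≥ n₀, ∀ t ≤ (n : ℝ≥0), ∀ k,
      dist (V (n + k) t ω) (V (n + (k + 1)) t ω) ≤ (2 * (1 / 2) ^ n) / 2 / 2 ^ k := by
    intro ω hω
    obtain ⟨n₀, hn₀⟩ := eventually_atTop.1 (hG ω hω).1
    refine ⟨n₀, fun n hn t ht k => ?_⟩
    have h1 := hn₀ (n + k) (by omega)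
    simp only [Set.mem_ofPred_eq, not_exists, not_and, not_lt] at h1
    have h2 := h1 t (ht.trans (by exact_mod_cast Nat.le_add_right n k))
    rw [dist_comm, dist_eq_norm]
    refine h2.trans (le_of_eq ?_)
    rw [pow_add, one_div_pow, one_div_pow]
    field_simp
  have hconv : ∀ ω ∈ G, ∀ t, ∃ x, Tendsto (fun n => V n t ω) atTop (𝓝 x) := by
    intro ω hω t
    obtain ⟨n₀, hn₀⟩ := hdist ω hω
    obtain ⟨n₁, hn₁⟩ := exists_nat_ge t
    have h1 := cauchySeq_of_le_geometric_two (hn₀ (max n₀ n₁) (le_max_left _ _) t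
      (hn₁.trans (by exact_mod_cast le_max_right n₀ n₁)))
    obtain ⟨x, hx⟩ := cauchySeq_tendsto_of_complete h1
    refine ⟨x, (tendsto_add_atTop_iff_nat (max n₀ n₁)).1 (hx.congr fun k => ?_)⟩
    rw [add_comm]
  let W₀ : ℝ≥0 → Ω → E := fun t ω =>
    if hω : ω ∈ G then (hconv ω hω t).choose else 0
  have hW₀ : ∀ ω ∈ G, ∀ t, Tendsto (fun n => V n t ω) atTop (𝓝 (W₀ t ω)) := by
    intro ω hω t
    simp only [W₀, hω, dite_true]
    exact (hconv ω hω t).choose_spec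
  have hW₀m : ∀ t, Measurable (W₀ t) := by
    intro t
    refine measurable_of_tendsto_metrizable (f := fun n => G.indicator (V n t))
      (fun n => (hm _ t).indicator hGm) (tendsto_pi_nhds.2 fun ω => ?_)
    by_cases hω : ω ∈ G
    · simp only [Set.indicator_of_mem hω]
      exact hW₀ ω hω t
    · simp only [Set.indicator_of_notMem hω, W₀, hω, dite_false]
      exact tendsto_const_nhds
  refine ⟨W₀, hW₀m, ?_, fun t => ?_⟩
  · filter_upwards [hGae] with ω hω
    refine isCadlag_of_uniform_approx fun T ε hε => ?_
    obtain ⟨n₀, hn₀⟩ := hdist ω hω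
    obtain ⟨n₁, hn₁⟩ := exists_nat_ge T
    obtain ⟨n₂, hn₂⟩ := exists_pow_lt_of_lt_one (show 0 < ε / 2 by positivity)
      (show (1 / 2 : ℝ) < 1 by norm_num)
    set n := max n₀ (max n₁ n₂) with hn
    refine ⟨fun t => V n t ω, (hG ω hω).2 n, fun t ht => ?_⟩
    have h1 := dist_le_of_le_geometric_two_of_tendsto₀ (hn₀ n (le_max_left _ _) t
      ((ht.trans hn₁).trans (by
        exact_mod_cast (le_max_left n₁ n₂).trans (le_max_right n₀ _))))
      (((tendsto_add_atTop_iff_nat n).2 (hW₀ ω hω t)).congr fun k => by rw [add_comm])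
    rw [add_zero, dist_comm, dist_eq_norm] at h1
    refine h1.trans ?_
    have h2 : (1 / 2 : ℝ) ^ n ≤ (1 / 2) ^ n₂ :=
      pow_le_pow_of_le_one (by norm_num) (by norm_num)
        ((le_max_right n₁ n₂).trans (le_max_right n₀ _))
    linarith
  · have hVlim : TendstoInMeasure P (fun n => V n t) atTop (W₀ t) :=
      tendstoInMeasure_of_tendsto_ae (fun n => (hm _ t).aestronglyMeasurable)
        (hGae.mono fun ω hω => hW₀ ω hω t)
    rw [tendstoInMeasure_iff_norm] at hVlim ⊢
    intro ε hε
    rw [ENNReal.tendsto_nhds_zero]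
    intro δ hδ
    have h1 := ENNReal.tendsto_nhds_zero.1 (hVlim (ε / 2) (by positivity)) (δ / 2)
      (ENNReal.div_pos hδ.ne' (by simp))
    have hpow : Tendsto (fun n : ℕ => (1 / 2 : ℝ) ^ n) atTop (𝓝 0) :=
      tendsto_pow_atTop_nhds_zero_of_lt_one (by norm_num) (by norm_num)
    have h2 : ∀ᶠ n : ℕ in atTop, (1 / 2 : ℝ) ^ n < ε / 2 :=
      hpow.eventually (gt_mem_nhds (by positivity))
    have h3 : ∀ᶠ n : ℕ in atTop, ENNReal.ofReal ((1 / 2 : ℝ) ^ n) ≤ δ / 2 := by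
      have := ENNReal.tendsto_ofReal hpow
      rw [ENNReal.ofReal_zero] at this
      exact ENNReal.tendsto_nhds_zero.1 this _ (ENNReal.div_pos hδ.ne' (by simp))
    have h4 : ∀ᶠ n : ℕ in atTop, t ≤ (n : ℝ≥0) := by
      obtain ⟨n₁, hn₁⟩ := exists_nat_ge t
      filter_upwards [eventually_ge_atTop n₁] with n hn
      exact hn₁.trans (by exact_mod_cast hn)
    -- The sequence `e` need not be cofinal in `ι`; the whole family is controlled by comparing `W
    -- j`, for `j ≥ e n`, with the single term `V n`.
    obtain ⟨n, hn1, hn2, hn3, hn4⟩ := (h1.and (h2.and (h3.and h4))).exists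
    filter_upwards [eventually_ge_atTop (e n)] with j hj
    calc P {ω | ε ≤ ‖W j t ω - W₀ t ω‖}
        ≤ P ({ω | ∃ t ≤ (n : ℝ≥0), (1 / 2 : ℝ) ^ n < ‖W j t ω - W (e n) t ω‖} ∪
            {ω | ε / 2 ≤ ‖V n t ω - W₀ t ω‖}) := by
          refine measure_mono fun ω hω => ?_
          by_contra hcon
          simp only [Set.mem_union, Set.mem_ofPred_eq, not_or, not_exists, not_and, not_lt,
            not_le] at hcon hω
          have h5 := hcon.1 t hn4
          have h6 := norm_add_le (W j t ω - W (e n) t ω) (V n t ω - W₀ t ω)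
          rw [hV, sub_add_sub_cancel] at h6
          simp only [hV] at hcon
          linarith [hcon.2]
      _ ≤ _ := measure_union_le _ _
      _ ≤ δ / 2 + δ / 2 := add_le_add ((hN n (e n) j (heN n) hj).trans hn3) hn1
      _ = δ := ENNReal.add_halves δ

/-- Convergence in probability is complete. -/
theorem exists_tendstoInMeasure_of_cauchy [Nonempty ι] {Z : ι → Ω → E} (hm : ∀ i, Measurable (Z i))
    (hC : TendstoInMeasure P (fun (p : ι × ι) ω => Z p.2 ω - Z p.1 ω)
      (atTop ⊓ 𝓟 {p | p.1 ≤ p.2}) (fun _ => 0)) :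
    ∃ Z₀ : Ω → E, Measurable Z₀ ∧ TendstoInMeasure P Z atTop Z₀ := by
  rw [tendstoInMeasure_iff_norm] at hC
  -- Each variable is viewed as a process constant in time.
  obtain ⟨W₀, h1, _, h2⟩ := exists_cadlag_limit_of_cauchy (P := P) (W := fun i _ => Z i)
    (fun i _ => hm i) (fun i => ae_of_all _ fun ω => isCadlag_const _) (fun T ε hε => by
      have h3 := ENNReal.tendsto_nhds_zero.1 (hC ε hε) (ENNReal.ofReal ε)
        (ENNReal.ofReal_pos.2 hε)
      rw [eventually_inf_principal] at h3
      obtain ⟨⟨A, B⟩, hAB⟩ := eventually_atTop.1 h3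
      refine ⟨A ⊔ B, fun i j hi hij => ?_⟩
      refine (measure_mono ?_).trans
        (hAB (i, j) ⟨le_sup_left.trans hi, (le_sup_right.trans hi).trans hij⟩ hij)
      rintro ω ⟨t, _, ht⟩
      simp only [Set.mem_ofPred_eq, sub_zero]
      exact ht.le)
  exact ⟨W₀ 0, h1 0, h2 0⟩

end Limit

/-! ### Càdlàg limits from vanishing exponents. -/

section Exponents

variable {Ω : Type*} [MeasurableSpace Ω] {P : Measure Ω} [IsProbabilityMeasure P]
  {E : Type*} [NormedAddCommGroup E] [InnerProductSpace ℝ E]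
  [MeasurableSpace E] [BorelSpace E] [FiniteDimensional ℝ E]
  {ι : Type*} [SemilatticeSup ι] [Nonempty ι] [(atTop : Filter (ι × ι)).IsCountablyGenerated]

/-- A family of càdlàg processes whose differences have exponents tending to zero has a càdlàg
limit. -/
theorem exists_cadlag_limit {W : ι → ℝ≥0 → Ω → E} {κ : ι → ι → E → ℂ}
    (hm : ∀ i t, Measurable (W i t)) (hcad : ∀ i, ∀ᵐ ω ∂P, IsCadlag fun t => W i t ω)
    (hsub : ∀ i j, i ≤ j → HasExponent (fun t ω => W j t ω - W i t ω) P (κ i j))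
    (hκ : ∀ u, Tendsto (fun p : ι × ι => κ p.1 p.2 u) (atTop ⊓ 𝓟 {p | p.1 ≤ p.2}) (𝓝 0)) :
    ∃ W₀ : ℝ≥0 → Ω → E, (∀ t, Measurable (W₀ t)) ∧ (∀ᵐ ω ∂P, IsCadlag fun t => W₀ t ω) ∧
      ∀ t, TendstoInMeasure P (fun i => W i t) atTop (W₀ t) := by
  have hsc : SecondCountableTopology E :=
    have := FiniteDimensional.proper_real E; inferInstance
  have hcs : CompleteSpace E := FiniteDimensional.complete ℝ E
  refine exists_cadlag_limit_of_cauchy hm hcad fun T ε hε => ?_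
  -- Exponents of differences are given only for ordered pairs, so the index set is the subtype of
  -- pairs `i ≤ j`.
  have h1 := eventually_measure_exists_le (P := P)
    (l := comap (Subtype.val : {p : ι × ι // p.1 ≤ p.2} → ι × ι) atTop)
    (W := fun p t ω => W p.1.2 t ω - W p.1.1 t ω) (κ := fun p => κ p.1.1 p.1.2)
    (fun p => hsub _ _ p.2)
    (fun p => by
      filter_upwards [hcad p.1.1, hcad p.1.2] with ω h1 h2
      exact h2.sub h1)
    (fun u => (hκ u).comp (tendsto_inf.2 ⟨tendsto_comap,
      tendsto_principal.2 (Eventually.of_forall fun p => p.2)⟩)) T hε (ENNReal.ofReal_pos.2 hε)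
  rw [eventually_comap] at h1
  obtain ⟨⟨A, B⟩, hAB⟩ := eventually_atTop.1 h1
  exact ⟨A ⊔ B, fun i j hi hij => hAB (i, j)
    ⟨le_sup_left.trans hi, (le_sup_right.trans hi).trans hij⟩ ⟨(i, j), hij⟩ rfl⟩

end Exponents

/-! ### Infinite divisibility with respect to time. -/

section TimeDivisible

variable {Ω : Type*} [MeasurableSpace Ω] {P : Measure Ω}
  {E : Type*} [NormedAddCommGroup E] [InnerProductSpace ℝ E] [MeasurableSpace E]

/-- Under a time change by a constant factor, the joint characteristic functions of a process with
an exponent are raised to the corresponding power. -/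
lemma HasExponent.exists_ch_sum_eq {L : ℝ≥0 → Ω → E} {ψ : E → ℂ} (hL : HasExponent L P ψ)
    {κ : Type*} (s : Finset κ) (a : κ → ℝ≥0) (u : κ → E) :
    ∃ K : ℂ, ∀ c : ℝ≥0, ch P (fun ω => ∑ i ∈ s, ⟪L (c * a i) ω, u i⟫_ℝ) = Complex.exp (c * K) := by
  classical
  obtain ⟨N, τ, m, hτ, hτ0, -, hm⟩ := exists_grid (s.image a)
  -- Summation by parts: the increment over cell `j` enters `L (c * a i)` exactly when the cell lies
  -- before `a i`.
  set v : ℕ → E := fun j => ∑ i ∈ s, if j < m (a i) then u i else 0 with hv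
  refine ⟨∑ j ∈ Finset.range N, (((τ (j + 1) : ℝ) - τ j : ℝ) : ℂ) * ψ (v j), fun c => ?_⟩
  have h1 := (hL.comp_mul c).ch_eq N τ hτ v
  have h2 : ch P (fun ω => ∑ i ∈ s, ⟪L (c * a i) ω, u i⟫_ℝ) = ch P (fun ω =>
      ∑ j ∈ Finset.range N, ⟪L (c * τ (j + 1)) ω - L (c * τ j) ω, v j⟫_ℝ) := by
    refine ch_congr ?_
    filter_upwards [hL.start] with ω hω
    simp only [hv, inner_sum]
    rw [Finset.sum_comm]
    refine Finset.sum_congr rfl fun i hi => ?_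
    obtain ⟨hmN, hmt⟩ := hm (a i) (Finset.mem_image_of_mem a hi)
    have h3 := sum_range_ite_sub (fun j => ⟪L (c * τ j) ω, u i⟫_ℝ) hmN
    simp only [hmt, hτ0, mul_zero, hω, inner_zero_left, sub_zero] at h3
    rw [← h3]
    refine Finset.sum_congr rfl fun j _ => ?_
    split_ifs
    · rw [inner_sub_left]
    · rw [inner_zero_right]
  rw [h2, h1, Finset.mul_sum]
  congr 1
  refine Finset.sum_congr rfl fun j _ => ?_
  push_cast
  ring

/-- The joint characteristic functions of `(Y (n t))_t` are the `n`-th powers of those of `Y`. -/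
def TimeDivisible (Y : ℝ≥0 → Ω → E) (P : Measure Ω) : Prop :=
  ∀ (n : ℕ) (s : Finset ℝ≥0) (u : ℝ≥0 → E),
    ch P (fun ω => ∑ t ∈ s, ⟪Y (n * t) ω, u t⟫_ℝ) = ch P (fun ω => ∑ t ∈ s, ⟪Y t ω, u t⟫_ℝ) ^ n

lemma HasExponent.timeDivisible {L : ℝ≥0 → Ω → E} {ψ : E → ℂ} (hL : HasExponent L P ψ) {h : ℝ≥0}
    (φ : Step h) : TimeDivisible (fun t => φ.integral fun s => L (t * s)) P := by
  intro n s u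
  -- Step integrals at finitely many `t` are combinations of values of `L` at the times `t * φ.t j`;
  -- the Boolean selects the right or left endpoint and its sign. Comparing `c = n` with `c = 1`
  -- gives the power.
  obtain ⟨K, hK⟩ := hL.exists_ch_sum_eq (s ×ˢ Finset.range φ.n ×ˢ (Finset.univ : Finset Bool))
    (fun p => p.1 * φ.t (p.2.1 + if p.2.2 then 1 else 0))
    (fun p => (φ.c p.2.1 * if p.2.2 then 1 else -1) • u p.1)
  have h1 : ∀ c : ℝ≥0, ch P (fun ω => ∑ t ∈ s,
      ⟪φ.integral (fun r => L (c * t * r)) ω, u t⟫_ℝ) = Complex.exp (c * K) := by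
    intro c
    rw [← hK c]
    congr 1
    ext ω
    rw [Finset.sum_product]
    refine Finset.sum_congr rfl fun t _ => ?_
    rw [Finset.sum_product, Step.integral, sum_inner]
    refine Finset.sum_congr rfl fun j _ => ?_
    simp [real_inner_smul_left, real_inner_smul_right, inner_sub_left, mul_assoc]
    ring
  have h2 := h1 n
  have h3 := h1 1
  simp only [one_mul, NNReal.coe_one, Complex.ofReal_one] at h3
  rw [h2, h3, ← Complex.exp_nat_mul]
  simp

variable [IsProbabilityMeasure P] [BorelSpace E]

lemma TimeDivisible.of_tendsto {ι : Type*} {l : Filter ι} [l.NeBot]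
    {Y : ι → ℝ≥0 → Ω → E} {Y₀ : ℝ≥0 → Ω → E} (hm : ∀ i t, Measurable (Y i t))
    (hm₀ : ∀ t, Measurable (Y₀ t)) (hY : ∀ i, TimeDivisible (Y i) P)
    (hlim : ∀ t, TendstoInMeasure P (fun i => Y i t) l (Y₀ t)) : TimeDivisible Y₀ P := by
  have key : ∀ (s : Finset ℝ≥0) (a : ℝ≥0 → ℝ≥0) (u : ℝ≥0 → E),
      Tendsto (fun i => ch P (fun ω => ∑ t ∈ s, ⟪Y i (a t) ω, u t⟫_ℝ)) l
        (𝓝 (ch P (fun ω => ∑ t ∈ s, ⟪Y₀ (a t) ω, u t⟫_ℝ))) := by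
    intro s a u
    refine tendsto_ch (fun i => ?_) ?_ ?_
    · exact (Finset.measurable_fun_sum s fun t _ =>
        measurable_inner_const (hm i (a t)) (u t)).aemeasurable
    · exact (Finset.measurable_fun_sum s fun t _ =>
        measurable_inner_const (hm₀ (a t)) (u t)).aemeasurable
    · exact tendstoInMeasure_finsetSum (F := fun t i ω => ⟪Y i (a t) ω, u t⟫_ℝ)
        (G := fun t ω => ⟪Y₀ (a t) ω, u t⟫_ℝ) s fun t _ =>
          tendstoInMeasure_inner (hlim (a t)) (u t)
  intro n s u
  refine tendsto_nhds_unique (key s (fun t => n * t) u) ?_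
  simp only [fun i => hY i n s u]
  exact (key s id u).pow n

/-- On the product space, Fubini turns the joint characteristic function of the sum of `n` copies
into an `n`-th power. -/
lemma TimeDivisible.isIDT [FiniteDimensional ℝ E] {X : ℝ≥0 → Ω → E}
    (hm : ∀ t, Measurable (X t)) (hX : TimeDivisible X P) : IsIDT X P where
  measurable := hm
  law_eq n _ := by
    have hsc : SecondCountableTopology E :=
      have := FiniteDimensional.proper_real E; inferInstance
    refine sameLaw_of_ch_eq (fun t => hm _) (fun t => Finset.measurable_fun_sum _ fun i _ =>
      (hm t).comp (measurable_pi_apply i)) fun s u => ?_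
    rw [hX n s u]
    have h1 := integral_fintype_prod_eq_pow (ι := Fin n) (μ := P)
      (fun ω => Complex.exp (((∑ t ∈ s, ⟪X t ω, u t⟫_ℝ : ℝ) : ℂ) * Complex.I))
    rw [Fintype.card_fin] at h1
    rw [ch, ← h1, ch]
    refine integral_congr_ae (ae_of_all _ fun ω => ?_)
    simp only
    rw [← Complex.exp_sum, ← Finset.sum_mul, ← Complex.ofReal_sum, Finset.sum_comm]
    simp only [sum_inner]

end TimeDivisible

/-! ### Existence of integrals. -/

section Improper

variable {Ω : Type*} [MeasurableSpace Ω] {P : Measure Ω}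
  {E : Type*} [NormedAddCommGroup E] [InnerProductSpace ℝ E] {f : ℝ≥0 → ℝ}

lemma tendsto_setIntegral_Ioc_zero (hφ : ∀ h, ∃ φ, IsApprox f h φ)
    (hf : ∀ h : ℝ≥0, ∃ C : ℝ, ∀ s ≤ h, |f s| ≤ C) {Ψ : E → ℂ} (hc : Continuous Ψ) {u : E} {z : ℂ}
    (hz : Tendsto (fun h : ℝ≥0 => ∫ s in Set.Ioc (0 : ℝ) h, Ψ (f s.toNNReal • u)) atTop (𝓝 z)) :
    Tendsto (fun p : ℝ≥0 × ℝ≥0 => ∫ s in Set.Ioc (p.1 : ℝ) p.2, Ψ (f s.toNNReal • u))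
      (atTop ⊓ 𝓟 {p | p.1 ≤ p.2}) (𝓝 0) := by
  have h1 : Tendsto (fun p : ℝ≥0 × ℝ≥0 => (∫ s in Set.Ioc (0 : ℝ) p.2, Ψ (f s.toNNReal • u)) -
      ∫ s in Set.Ioc (0 : ℝ) p.1, Ψ (f s.toNNReal • u)) atTop (𝓝 (z - z)) := by
    rw [← prod_atTop_atTop_eq]
    exact (hz.comp tendsto_snd).sub (hz.comp tendsto_fst)
  rw [sub_self] at h1
  refine (h1.mono_left inf_le_left).congr' ?_
  rw [EventuallyEq, eventually_inf_principal]
  exact Eventually.of_forall fun p hp => (setIntegral_Ioc_eq_sub hφ hf hc u hp).symm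

variable [MeasurableSpace E] [BorelSpace E] [FiniteDimensional ℝ E] [IsProbabilityMeasure P]

/-- Existence of the stochastic integral on a bounded interval. -/
theorem StepExponent.exists_hasIntegral {Z : ℝ≥0 → Ω → E} {Ψ : E → ℂ} (hZ : StepExponent Z P Ψ)
    (hc : Continuous Ψ) (hΨ : Ψ 0 = 0) {h : ℝ≥0} {φ : ℕ → Step h} (hφ : IsApprox f h φ) :
    ∃ I, HasIntegral f Z P h I := by
  have hsc : SecondCountableTopology E :=
    have := FiniteDimensional.proper_real E; inferInstance
  have hcs : CompleteSpace E := FiniteDimensional.complete ℝ E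
  have h1 := (hZ.tendstoInMeasure_sub hc hΨ hφ hφ).comp
    (tendsto_snd.prodMk tendsto_fst : Tendsto (fun p : ℕ × ℕ => (p.2, p.1)) (atTop ×ˢ atTop) _)
  rw [prod_atTop_atTop_eq] at h1
  obtain ⟨I, hI, hlim⟩ := exists_tendstoInMeasure_of_cauchy
    (fun k => (φ k).measurable_integral hZ.measurable) (h1.mono inf_le_left)
  exact ⟨I, hasIntegral_iff.2 ⟨hI, φ, hφ, hlim⟩⟩

/-- Existence of the improper integral when the integrated exponents converge. -/
theorem StepExponent.exists_hasImproperIntegral {Z : ℝ≥0 → Ω → E} {Ψ : E → ℂ}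
    (hZ : StepExponent Z P Ψ) (hc : Continuous Ψ) (hΨ : Ψ 0 = 0)
    (hφ : ∀ h, ∃ φ, IsApprox f h φ) (hf : ∀ h : ℝ≥0, ∃ C : ℝ, ∀ s ≤ h, |f s| ≤ C) {κ : E → ℂ}
    (hκ : ∀ u, Tendsto (fun h : ℝ≥0 => ∫ s in Set.Ioc (0 : ℝ) h, Ψ (f s.toNNReal • u)) atTop
      (𝓝 (κ u))) : ∃ I, HasImproperIntegral f Z P I := by
  have hsc : SecondCountableTopology E :=
    have := FiniteDimensional.proper_real E; inferInstance
  have hcs : CompleteSpace E := FiniteDimensional.complete ℝ E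
  choose J hJ using fun h => hZ.exists_hasIntegral hc hΨ (hφ h).choose_spec
  obtain ⟨I, hI, hlim⟩ := exists_tendstoInMeasure_of_cauchy (P := P) (fun h => (hJ h).1) (by
    refine tendstoInMeasure_zero_of_tendsto_ch (fun p => (hJ p.2).1.sub (hJ p.1).1) fun u => ?_
    have h1 := (tendsto_setIntegral_Ioc_zero hφ hf hc (hκ u)).cexp
    rw [Complex.exp_zero] at h1
    refine h1.congr' ?_
    rw [EventuallyEq, eventually_inf_principal]
    exact Eventually.of_forall fun p hp =>
      (ch_sub_of_hasIntegral hZ hc hΨ hp (hJ p.1) (hJ p.2) u).symm)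
  exact ⟨I, hI, J, hJ, hlim⟩

end Improper

/-! ### Integrals against the sheet as processes in `t`. -/

section Sheet

variable {Ω Ω' : Type*} [MeasurableSpace Ω] [MeasurableSpace Ω'] {P : Measure Ω} {P' : Measure Ω'}
  [IsProbabilityMeasure P']
  {E : Type*} [NormedAddCommGroup E] [InnerProductSpace ℝ E]
  [MeasurableSpace E] [BorelSpace E] [FiniteDimensional ℝ E]
  {L : ℝ≥0 → Ω → E} {M : ℝ≥0 → ℝ≥0 → Ω' → E} {ψ κ : E → ℂ} {f : ℝ≥0 → ℝ}

/-- The integrals `∫_0^h f(s) d_s M_{t,s}` form a process with exponent in `t`. -/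
lemma IsLevySheetExtending.hasExponent_integral (hM : IsLevySheetExtending M P' L P)
    (hL : HasExponent L P ψ) (hc : Continuous ψ) (hψ : ψ 0 = 0) {h : ℝ≥0} {φ : ℕ → Step h}
    (hφ : IsApprox f h φ) {J : ℝ≥0 → Ω' → E} (hJ : ∀ t, HasIntegral f (M t) P' h (J t)) :
    HasExponent J P' fun u => ∫ s in Set.Ioc (0 : ℝ) h, ψ (f s.toNNReal • u) :=
  HasExponent.of_tendsto (fun k => hM.hasExponent hL (φ k)) (hφ.tendsto_expo hc hψ)
    (fun t => (hJ t).1) fun t => (hJ t).tendstoInMeasure (hM.stepExponent hL t) (by fun_prop)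
      (by simp [hψ]) hφ

/-- A difference of two processes with exponents need not have one; here it does, being a limit of
integrals of the single step functions `φ' - φ`. -/
lemma IsLevySheetExtending.hasExponent_integral_sub (hM : IsLevySheetExtending M P' L P)
    (hL : HasExponent L P ψ) (hc : Continuous ψ) (hψ : ψ 0 = 0) {a b : ℝ≥0} (hab : a ≤ b)
    {φ : ℕ → Step a} {φ' : ℕ → Step b} (hφ : IsApprox f a φ) (hφ' : IsApprox f b φ')
    {I J : ℝ≥0 → Ω' → E}
    (hI : ∀ t, HasIntegral f (M t) P' a (I t)) (hJ : ∀ t, HasIntegral f (M t) P' b (J t)) :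
    HasExponent (fun t ω => J t ω - I t ω) P'
      fun u => ∫ s in Set.Ioc (a : ℝ) b, ψ (f s.toNNReal • u) := by
  have hsc : SecondCountableTopology E :=
    have := FiniteDimensional.proper_real E; inferInstance
  have hexpo : ∀ u, Tendsto (fun k => ((φ' k).sub ((φ k).up hab)).expo ψ u) atTop
      (𝓝 (∫ s in Set.Ioc (a : ℝ) b, ψ (f s.toNNReal • u))) := fun u => by
    have h1 := (IsApprox.tendsto_expo_sub_up hab hφ hφ' hc hψ u).comp
      (tendsto_id.prodMk tendsto_id : Tendsto (fun k : ℕ => (k, k)) atTop (atTop ×ˢ atTop))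
    simpa only [Function.comp_def, id_eq] using h1
  refine HasExponent.of_tendsto (l := atTop)
    (W := fun k t => ((φ' k).sub ((φ k).up hab)).integral (M t))
    (κ := fun k => ((φ' k).sub ((φ k).up hab)).expo ψ)
    (W₀ := fun t ω => J t ω - I t ω)
    (fun k : ℕ => hM.hasExponent hL ((φ' k).sub ((φ k).up hab)))
    hexpo (fun t => (hJ t).1.sub (hI t).1) fun t => ?_
  have h1 := tendstoInMeasure_sub (F := fun k => (φ' k).integral (M t))
    (F' := fun k => (φ k).integral (M t))
    ((hJ t).tendstoInMeasure (hM.stepExponent hL t) (by fun_prop) (by simp [hψ]) hφ')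
    ((hI t).tendstoInMeasure (hM.stepExponent hL t) (by fun_prop) (by simp [hψ]) hφ)
  refine h1.congr_left fun k => ae_of_all _ fun ω => ?_
  rw [Step.integral_sub, Step.integral_up]

/-- The integrals `∫_0^∞ f(s) d_s M_{t,s}` form a process with exponent in `t`. -/
lemma IsLevySheetExtending.hasExponent_improperIntegral (hM : IsLevySheetExtending M P' L P)
    (hL : HasExponent L P ψ) (hc : Continuous ψ) (hψ : ψ 0 = 0) (hφ : ∀ h, ∃ φ, IsApprox f h φ)
    (hκ : ∀ u, Tendsto (fun h : ℝ≥0 => ∫ s in Set.Ioc (0 : ℝ) h, ψ (f s.toNNReal • u)) atTop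
      (𝓝 (κ u))) {Y : ℝ≥0 → Ω' → E} (hY : ∀ t, HasImproperIntegral f (M t) P' (Y t)) :
    HasExponent Y P' κ := by
  choose hYm J hJ hlim using hY
  exact HasExponent.of_tendsto (W := fun h t => J t h)
    (fun h => hM.hasExponent_integral hL hc hψ (hφ h).choose_spec fun t => hJ t h) hκ hYm hlim

/-- The integrals `∫_0^h f(s) d_s M_{t,s}` have versions with càdlàg paths in `t`. -/
lemma IsLevySheetExtending.exists_cadlag_integral (hM : IsLevySheetExtending M P' L P)
    (hL : HasExponent L P ψ) (hc : Continuous ψ) (hψ : ψ 0 = 0) {h : ℝ≥0} {φ : ℕ → Step h}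
    (hφ : IsApprox f h φ) : ∃ J : ℝ≥0 → Ω' → E, (∀ t, HasIntegral f (M t) P' h (J t)) ∧
      ∀ᵐ ω ∂P', IsCadlag fun t => J t ω := by
  obtain ⟨J, hJm, hJc, hlim⟩ := exists_cadlag_limit (P := P')
    (W := fun k t => (φ k).integral (M t)) (κ := fun i j => ((φ j).sub (φ i)).expo ψ)
    (fun k t => (hM.hasExponent hL (φ k)).measurable t)
    (fun k => hM.cadlag.mono fun ω hω => (φ k).isCadlag_integral fun s => (hω 0 s).2)
    (fun i j _ => by
      have := hM.hasExponent hL ((φ j).sub (φ i))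
      simpa only [← Step.integral_sub] using this)
    (fun u => by
      have h1 := (hφ.tendsto_expo_sub hφ hc hψ u).comp
        (tendsto_snd.prodMk tendsto_fst : Tendsto (fun p : ℕ × ℕ => (p.2, p.1))
          (atTop ×ˢ atTop) _)
      rw [prod_atTop_atTop_eq] at h1
      exact h1.mono_left inf_le_left)
  exact ⟨J, fun t => hasIntegral_iff.2 ⟨hJm t, φ, hφ, hlim t⟩, hJc⟩

/-- The integrals `∫_0^∞ f(s) d_s M_{t,s}` have versions with càdlàg paths in `t`. -/
lemma IsLevySheetExtending.exists_cadlag_improperIntegral (hM : IsLevySheetExtending M P' L P)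
    (hL : HasExponent L P ψ) (hc : Continuous ψ) (hψ : ψ 0 = 0) (hφ : ∀ h, ∃ φ, IsApprox f h φ)
    (hf : ∀ h : ℝ≥0, ∃ C : ℝ, ∀ s ≤ h, |f s| ≤ C)
    (hκ : ∀ u, Tendsto (fun h : ℝ≥0 => ∫ s in Set.Ioc (0 : ℝ) h, ψ (f s.toNNReal • u)) atTop
      (𝓝 (κ u))) :
    ∃ Y : ℝ≥0 → Ω' → E, (∀ t, HasImproperIntegral f (M t) P' (Y t)) ∧
      ∀ᵐ ω ∂P', IsCadlag fun t => Y t ω := by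
  choose J hJ hJc using fun h =>
    hM.exists_cadlag_integral hL hc hψ (f := f) (hφ h).choose_spec
  -- The family is now indexed by the horizon `h`, with the integrals over `(a, b]` as differences.
  obtain ⟨Y, hYm, hYc, hlim⟩ := exists_cadlag_limit (P := P') (W := J)
    (κ := fun a b u => ∫ s in Set.Ioc (a : ℝ) b, ψ (f s.toNNReal • u))
    (fun h t => (hJ h t).1) hJc
    (fun a b hab => hM.hasExponent_integral_sub hL hc hψ hab (hφ a).choose_spec
      (hφ b).choose_spec (hJ a) (hJ b))
    (fun u => tendsto_setIntegral_Ioc_zero hφ hf hc (hκ u))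
  exact ⟨Y, fun t => ⟨hYm t, fun h => J h t, fun h => hJ h t, hlim t⟩, hYc⟩

end Sheet

/-- The integrals `∫_0^∞ f(s) dL_{ts}` form an IDT process in `t`. -/
theorem HasExponent.isIDT {Ω : Type*} [MeasurableSpace Ω] {P : Measure Ω} [IsProbabilityMeasure P]
    {E : Type*} [NormedAddCommGroup E] [InnerProductSpace ℝ E] [MeasurableSpace E] [BorelSpace E]
    [FiniteDimensional ℝ E] {L : ℝ≥0 → Ω → E} {ψ : E → ℂ} {f : ℝ≥0 → ℝ}
    (hL : HasExponent L P ψ) (hc : Continuous ψ) (hψ : ψ 0 = 0) (hφ : ∀ h, ∃ φ, IsApprox f h φ)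
    {X : ℝ≥0 → Ω → E} (hX : ∀ t, HasImproperIntegral f (fun s => L (t * s)) P (X t)) :
    IsIDT X P := by
  have hsc : SecondCountableTopology E :=
    have := FiniteDimensional.proper_real E; inferInstance
  choose hXm J hJ hlim using hX
  refine TimeDivisible.isIDT hXm (TimeDivisible.of_tendsto (Y := fun h t => J t h)
    (fun h t => (hJ t h).1) hXm (fun h => ?_) hlim)
  obtain ⟨φ, hφ⟩ := hφ h
  exact TimeDivisible.of_tendsto
    (fun k t => (φ k).measurable_integral fun s => hL.measurable (t * s)) (fun t => (hJ t h).1)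
    (fun k => hL.timeDivisible (φ k)) fun t =>
      (hJ t h).tendstoInMeasure (hL.comp_mul t).stepExponent (by fun_prop) (by simp [hψ]) hφ

end LevyIDT

end

theorem proposition2p2 {d : ℕ} {Ω Ω' : Type*} [MeasurableSpace Ω] [MeasurableSpace Ω']
    (P : Measure Ω) [IsProbabilityMeasure P] (P' : Measure Ω') [IsProbabilityMeasure P']
    (L : ℝ≥0 → Ω → EuclideanSpace ℝ (Fin d)) (hL : LevyIDT.IsLevy L P)
    (M : ℝ≥0 → ℝ≥0 → Ω' → EuclideanSpace ℝ (Fin d))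
    (hM : LevyIDT.IsLevySheetExtending M P' L P)
    (f : ℝ≥0 → ℝ) (hf : ∀ h : ℝ≥0, ∃ C : ℝ, ∀ s ≤ h, |f s| ≤ C)
    (hint : ∃ I, LevyIDT.HasImproperIntegral f L P I) :
    -- the integrals `X_t = ∫_0^∞ f(s) dL_{ts}` are well defined
    (∀ t, ∃ I, LevyIDT.HasImproperIntegral f (fun s => L (t * s)) P I) ∧
    -- the integrals `∫_0^∞ f(s) d_s M_{t,s}` are well defined, and have versions which
    -- form a Lévy process in `t`
    (∃ Y : ℝ≥0 → Ω' → EuclideanSpace ℝ (Fin d),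
      (∀ t, LevyIDT.HasImproperIntegral f (M t) P' (Y t)) ∧ LevyIDT.IsLevy Y P') ∧
    -- whatever versions are chosen, `X` is IDT, `Y` is a Lévy process in law, and
    -- they have the same one-dimensional marginals
    (∀ X : ℝ≥0 → Ω → EuclideanSpace ℝ (Fin d),
      (∀ t, LevyIDT.HasImproperIntegral f (fun s => L (t * s)) P (X t)) → LevyIDT.IsIDT X P) ∧
    (∀ Y : ℝ≥0 → Ω' → EuclideanSpace ℝ (Fin d),
      (∀ t, LevyIDT.HasImproperIntegral f (M t) P' (Y t)) → LevyIDT.IsLevyInLaw Y P') ∧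
    (∀ (X : ℝ≥0 → Ω → EuclideanSpace ℝ (Fin d)) (Y : ℝ≥0 → Ω' → EuclideanSpace ℝ (Fin d)),
      (∀ t, LevyIDT.HasImproperIntegral f (fun s => L (t * s)) P (X t)) →
      (∀ t, LevyIDT.HasImproperIntegral f (M t) P' (Y t)) →
      ∀ t, IdentDistrib (X t) (Y t) P P') := by
  obtain ⟨ψ, hc, hψ, hLe⟩ := hL.toIsLevyInLaw.exists_hasExponent
  obtain ⟨I, hI⟩ := hint
  -- Approximability of `f` by step functions is part of the assumed existence of the integral
  -- against `L`.
  have hφ : ∀ h, ∃ φ, LevyIDT.IsApprox f h φ := fun h =>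
    let ⟨_, J, hJ, _⟩ := hI
    let ⟨_, φ, hφ, _⟩ := LevyIDT.hasIntegral_iff.1 (hJ h)
    ⟨φ, hφ⟩
  obtain ⟨κ, hκ⟩ := hI.exists_tendsto_exponent hLe.stepExponent hc hψ hf
  have hκt : ∀ (t : ℝ≥0) u, Tendsto (fun h : ℝ≥0 => ∫ s in Set.Ioc (0 : ℝ) h,
      (t : ℂ) * ψ (f s.toNNReal • u)) atTop (𝓝 ((t : ℂ) * κ u)) := fun t u => by
    simp only [integral_const_mul]
    exact (hκ u).const_mul _
  have hct : ∀ t : ℝ≥0, Continuous fun u => (t : ℂ) * ψ u := fun t => by fun_prop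
  have hψt : ∀ t : ℝ≥0, (t : ℂ) * ψ 0 = 0 := fun t => by simp [hψ]
  have hLt : ∀ t, LevyIDT.StepExponent (fun s => L (t * s)) P fun u => (t : ℂ) * ψ u := fun t =>
    (hLe.comp_mul t).stepExponent
  have hlevy : ∀ Y : ℝ≥0 → Ω' → EuclideanSpace ℝ (Fin d),
      (∀ t, LevyIDT.HasImproperIntegral f (M t) P' (Y t)) → LevyIDT.IsLevyInLaw Y P' :=
    fun Y hY => (hM.hasExponent_improperIntegral hLe hc hψ hφ hκ hY).isLevyInLaw
  refine ⟨fun t => (hLt t).exists_hasImproperIntegral (hct t) (hψt t) hφ hf (hκt t), ?_,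
    fun X hX => hLe.isIDT hc hψ hφ hX, hlevy, fun X Y hX hY t => ?_⟩
  · obtain ⟨Y, hY, hYc⟩ := hM.exists_cadlag_improperIntegral hLe hc hψ hφ hf hκ
    exact ⟨Y, hY, hlevy Y hY, hYc⟩
  -- Both characteristic functions equal `exp(t κ(u))`.
  · refine LevyIDT.identDistrib_of_ch_eq (hX t).1 (hY t).1 fun u => ?_
    rw [(hX t).ch_eq (hLt t) (hct t) (hψt t) (hκt t) u,
      (hY t).ch_eq (hM.stepExponent hLe t) (hct t) (hψt t) (hκt t) u]
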